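/- Let $\mathbb{A}=(A,\Omega)$ be a finite algebra with $A=\{0,\dots,l-1\}$ and $\Omega$ an idempotent special weak near-unanimity operation of arity $m$. $W^1_1$ is the three-sorted theory (numbers; strings, i.e. finite sets of numbers; classes, i.e. sets of strings) in the language $\{0,1,+,\cdot,|\ |,=_1,=_2,\le,\in_2,\in_3\}$ axiomatized by 2-BASIC, $\Sigma^{\mathscr B}_1$-IND, and the comprehension schemes $\forall y\,\exists Y\,(|Y|\le y\wedge\forall z<y\,(\phi(z)\leftrightarrow z\in Y))$ and $\forall y\,\exists\mathscr Y\,\forall Z\,(|Z|\le y\to(\phi(Z)\leftrightarrow Z\in\mathscr Y))$ for $\phi\in\Sigma^{\mathscr B}_0$, where $\Sigma^{\mathscr B}_0$-formulas have only bounded number and string quantifiers and no class quantifiers, and $\Sigma^{\mathscr B}_1$-formulas have in addition unbounded class quantifiers, all equivalent to existential ones. An instance $\Theta$ on variables $x_0,\dots,x_{n-1}$ (coded by strings) consists of a digraph with edge set $E$ on the variables, a non-empty subuniverse $D_i$ of $\mathbb{A}$ for every $i<n$, and a relation $E^{ij}\subseteq D_i\times D_j$ compatible with $\Omega$ for all $i,j<n$;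 a solution is a tuple $(a_0,\dots,a_{n-1})\in D_0\times\dots\times D_{n-1}$ with $(a_i,a_j)\in E^{ij}$ whenever $(i,j)\in E$, and the solutions form the relation $\mathscr R_\Theta$; for $k\le n$, $\Theta(x_0,\dots,x_{k-1})$ defines the projection of $\mathscr R_\Theta$ to the first $k$ coordinates. An instance $\Upsilon$ is a covering of $\Lambda$, written $\Upsilon\in Covering(\Lambda)$, if there is a homomorphism $F$ from the digraph of $\Upsilon$ to that of $\Lambda$ such that the domains of $x_i$ in $\Upsilon$ and of $F(x_i)$ in $\Lambda$ coincide, for each edge $(x_i,x_j)$ of $\Upsilon$ its relation equals the relation of $(F(x_i),F(x_j))$ in $\Lambda$, and $F(x_i)=x_i$ for each variable $x_i$ common to both instances. For an instance $\Lambda$ on $x_0,\dots,x_{n-1}$, a unary vector function is a tuple $\Psi=(\psi_0,\dots,\psi_{n-1})$ with $\psi_i:D_i\to D_i$, put $H^\Psi=(\psi_0(a_0),\dots,\psi_{n-1}(a_{n-1}))$ for $H=(a_0,\dots,a_{n-1})$, and let $UnPol^{\mathscr R_\Lambda}$ be the set of those $\Psi$ for which $H\in\mathscr R_\Lambda$ implies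 $H^\Psi\in\mathscr R_\Lambda$. Lemma 8.12 (formalized): $W^1_1$ proves that for every instance $\Lambda$ on variables $x_0,\dots,x_{n-1}$ (so that $\Lambda(x_0,\dots,x_{n-1})$ defines $\mathscr R_\Lambda$) and every $H\in D_0\times\dots\times D_{n-1}$, the class $\mathscr R'=\{H^\Psi:\Psi\in UnPol^{\mathscr R_\Lambda}\}$ exists, and there exists $\Upsilon\in Covering(\Lambda)$ whose variables include $x_0,\dots,x_{n-1}$ such that $\Upsilon(x_0,\dots,x_{n-1})$ defines $\mathscr R'$. -/

import Mathlib

/-! Third-order bounded arithmetic: syntax, structures, the theory `W11`, and, inside its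
language, formulas speaking about CSP instances with unary and binary constraints. -/

universe u

namespace BA

/-! ### The three-sorted language `0, 1, +, ·, | |, =₁, =₂, ≤, ∈₂, ∈₃` -/

/-- Names of string (second-sort) variables. -/
abbrev SVar := ℕ

/-- Names of class (third-sort) variables. -/
abbrev CVar := ℕ

/-- Number terms. There are no string terms or class terms besides variables. -/
inductive NTerm : Type
  | var (x : ℕ) : NTerm
  | zero : NTerm
  | one : NTerm
  | add (s t : NTerm) : NTerm
  | mul (s t : NTerm) : NTerm
  | len (X : SVar) : NTerm

/-- Formulas. Implication `φ → ψ` is written `¬φ ∨ ψ`. -/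
inductive Fml : Type
  | eqN (s t : NTerm) : Fml
  | le (s t : NTerm) : Fml
  | eqS (X Y : SVar) : Fml
  | memS (t : NTerm) (X : SVar) : Fml
  | memC (X : SVar) (C : CVar) : Fml
  | neg (φ : Fml) : Fml
  | and (φ ψ : Fml) : Fml
  | or (φ ψ : Fml) : Fml
  | exN (x : ℕ) (φ : Fml) : Fml
  | allN (x : ℕ) (φ : Fml) : Fml
  | exS (X : SVar) (φ : Fml) : Fml
  | allS (X : SVar) (φ : Fml) : Fml
  | exC (C : CVar) (φ : Fml) : Fml
  | allC (C : CVar) (φ : Fml) : Fml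

/-- The number variable `x` occurs in the term. -/
def NTerm.OccN (x : ℕ) : NTerm → Prop
  | .var y => x = y
  | .zero => False
  | .one => False
  | .add s t => s.OccN x ∨ t.OccN x
  | .mul s t => s.OccN x ∨ t.OccN x
  | .len _ => False

/-- The string variable `X` occurs in the term. -/
def NTerm.OccS (X : SVar) : NTerm → Prop
  | .var _ => False
  | .zero => False
  | .one => False
  | .add s t => s.OccS X ∨ t.OccS X
  | .mul s t => s.OccS X ∨ t.OccS X
  | .len Y => X = Y

/-- `Σ^𝓑_0`: all number and string quantifiers are bounded, there are no class quantifiers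
(free class variables are allowed). -/
inductive IsSigma0 : Fml → Prop
  | eqN (s t : NTerm) : IsSigma0 (.eqN s t)
  | le (s t : NTerm) : IsSigma0 (.le s t)
  | eqS (X Y : SVar) : IsSigma0 (.eqS X Y)
  | memS (t : NTerm) (X : SVar) : IsSigma0 (.memS t X)
  | memC (X : SVar) (C : CVar) : IsSigma0 (.memC X C)
  | neg {φ : Fml} : IsSigma0 φ → IsSigma0 (.neg φ)
  | and {φ ψ : Fml} : IsSigma0 φ → IsSigma0 ψ → IsSigma0 (.and φ ψ)
  | or {φ ψ : Fml} : IsSigma0 φ → IsSigma0 ψ → IsSigma0 (.or φ ψ)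
  | exN {x : ℕ} {t : NTerm} {φ : Fml} : ¬ t.OccN x → IsSigma0 φ →
      IsSigma0 (.exN x (.and (.le (.var x) t) φ))
  | allN {x : ℕ} {t : NTerm} {φ : Fml} : ¬ t.OccN x → IsSigma0 φ →
      IsSigma0 (.allN x (.or (.neg (.le (.var x) t)) φ))
  | exS {X : SVar} {t : NTerm} {φ : Fml} : ¬ t.OccS X → IsSigma0 φ →
      IsSigma0 (.exS X (.and (.le (.len X) t) φ))
  | allS {X : SVar} {t : NTerm} {φ : Fml} : ¬ t.OccS X → IsSigma0 φ →
      IsSigma0 (.allS X (.or (.neg (.le (.len X) t)) φ))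

/-- `IsLevel1 true` is `Σ^𝓑_1` and `IsLevel1 false` is its dual `Π^𝓑_1`: number and string
quantifiers are bounded and arbitrary, and every (unbounded) class quantifier is equivalent
to an existential one, respectively to a universal one. -/
inductive IsLevel1 : Bool → Fml → Prop
  | base {p : Bool} {φ : Fml} : IsSigma0 φ → IsLevel1 p φ
  | neg {p : Bool} {φ : Fml} : IsLevel1 (!p) φ → IsLevel1 p (.neg φ)
  | and {p : Bool} {φ ψ : Fml} : IsLevel1 p φ → IsLevel1 p ψ → IsLevel1 p (.and φ ψ)
  | or {p : Bool} {φ ψ : Fml} : IsLevel1 p φ → IsLevel1 p ψ → IsLevel1 p (.or φ ψ)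
  | exN {p : Bool} {x : ℕ} {t : NTerm} {φ : Fml} : ¬ t.OccN x → IsLevel1 p φ →
      IsLevel1 p (.exN x (.and (.le (.var x) t) φ))
  | allN {p : Bool} {x : ℕ} {t : NTerm} {φ : Fml} : ¬ t.OccN x → IsLevel1 p φ →
      IsLevel1 p (.allN x (.or (.neg (.le (.var x) t)) φ))
  | exS {p : Bool} {X : SVar} {t : NTerm} {φ : Fml} : ¬ t.OccS X → IsLevel1 p φ →
      IsLevel1 p (.exS X (.and (.le (.len X) t) φ))
  | allS {p : Bool} {X : SVar} {t : NTerm} {φ : Fml} : ¬ t.OccS X → IsLevel1 p φ →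
      IsLevel1 p (.allS X (.or (.neg (.le (.len X) t)) φ))
  | exC {C : CVar} {φ : Fml} : IsLevel1 true φ → IsLevel1 true (.exC C φ)
  | allC {C : CVar} {φ : Fml} : IsLevel1 false φ → IsLevel1 false (.allC C φ)

/-- `Σ^𝓑_1`. -/
def IsSigma1 (φ : Fml) : Prop := IsLevel1 true φ

/-! ### Structures and truth -/

/-- A three-sorted structure for the language; both equality symbols mean equality. -/
structure Model3 : Type (u + 1) where
  Num : Type u
  Str : Type u
  Cls : Type u
  zero : Num
  one : Num
  add : Num → Num → Num
  mul : Num → Num → Num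
  len : Str → Num
  le : Num → Num → Prop
  memS : Num → Str → Prop
  memC : Str → Cls → Prop
  str_nonempty : Nonempty Str
  cls_nonempty : Nonempty Cls

/-- `x < y` abbreviates `x ≤ y ∧ x ≠ y`. -/
def Model3.lt (M : Model3.{u}) (x y : M.Num) : Prop := M.le x y ∧ x ≠ y

/-- An assignment of values to the variables of the three sorts. -/
structure Env (M : Model3.{u}) : Type u where
  num : ℕ → M.Num
  str : SVar → M.Str
  cls : CVar → M.Cls

def Env.setN {M : Model3.{u}} (e : Env M) (x : ℕ) (a : M.Num) : Env M :=
  { e with num := Function.update e.num x a }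

def Env.setS {M : Model3.{u}} (e : Env M) (X : SVar) (A : M.Str) : Env M :=
  { e with str := Function.update e.str X A }

def Env.setC {M : Model3.{u}} (e : Env M) (C : CVar) (A : M.Cls) : Env M :=
  { e with cls := Function.update e.cls C A }

def NTerm.val (M : Model3.{u}) (e : Env M) : NTerm → M.Num
  | .var x => e.num x
  | .zero => M.zero
  | .one => M.one
  | .add s t => M.add (s.val M e) (t.val M e)
  | .mul s t => M.mul (s.val M e) (t.val M e)
  | .len X => M.len (e.str X)

/-- Tarski's truth definition. -/
def Fml.Holds (M : Model3.{u}) : Fml → Env M → Prop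
  | .eqN s t, e => s.val M e = t.val M e
  | .le s t, e => M.le (s.val M e) (t.val M e)
  | .eqS X Y, e => e.str X = e.str Y
  | .memS t X, e => M.memS (t.val M e) (e.str X)
  | .memC X C, e => M.memC (e.str X) (e.cls C)
  | .neg φ, e => ¬ φ.Holds M e
  | .and φ ψ, e => φ.Holds M e ∧ ψ.Holds M e
  | .or φ ψ, e => φ.Holds M e ∨ ψ.Holds M e
  | .exN x φ, e => ∃ a : M.Num, φ.Holds M (e.setN x a)
  | .allN x φ, e => ∀ a : M.Num, φ.Holds M (e.setN x a)
  | .exS X φ, e => ∃ A : M.Str, φ.Holds M (e.setS X A)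
  | .allS X φ, e => ∀ A : M.Str, φ.Holds M (e.setS X A)
  | .exC C φ, e => ∃ A : M.Cls, φ.Holds M (e.setC C A)
  | .allC C φ, e => ∀ A : M.Cls, φ.Holds M (e.setC C A)

/-! ### The theory -/

/-- The axioms `2-BASIC`. -/
structure Model3.Basic (M : Model3.{u}) : Prop where
  b1 : ∀ x, M.add x M.one ≠ M.zero
  b2 : ∀ x y, M.add x M.one = M.add y M.one → x = y
  b3 : ∀ x, M.add x M.zero = x
  b4 : ∀ x y, M.add x (M.add y M.one) = M.add (M.add x y) M.one
  b5 : ∀ x, M.mul x M.zero = M.zero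
  b6 : ∀ x y, M.mul x (M.add y M.one) = M.add (M.mul x y) x
  b7 : ∀ x y, M.le x y → M.le y x → x = y
  b8 : ∀ x y, M.le x (M.add x y)
  b9 : ∀ x, M.le M.zero x
  b10 : ∀ x y, M.le x y ∨ M.le y x
  b11 : ∀ x y, M.le x y ↔ M.lt x (M.add y M.one)
  b12 : ∀ x, x ≠ M.zero → ∃ y, M.le y x ∧ M.add y M.one = x
  l1 : ∀ X y, M.memS y X → M.lt y (M.len X)
  l2 : ∀ X y, M.add y M.one = M.len X → M.memS y X
  se : ∀ X Y, M.len X = M.len Y →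
    (∀ i, M.lt i (M.len X) → (M.memS i X ↔ M.memS i Y)) → X = Y

/-- `M` is a model of `W¹₁`: it satisfies (the universal closures of) `2-BASIC`,
`Σ^𝓑_1-IND`, `Σ^𝓑_0-2COMP` and `Σ^𝓑_0-3COMP`. In the schemes `φ` may have arbitrary further
free variables of all sorts; their values are those given by the assignment `e`. -/
structure Model3.IsModelW11 (M : Model3.{u}) : Prop where
  basic : M.Basic
  ind : ∀ φ : Fml, IsSigma1 φ → ∀ (x : ℕ) (e : Env M),
    φ.Holds M (e.setN x M.zero) →
    (∀ a, φ.Holds M (e.setN x a) → φ.Holds M (e.setN x (M.add a M.one))) →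
    ∀ a, φ.Holds M (e.setN x a)
  comp2 : ∀ φ : Fml, IsSigma0 φ → ∀ (x : ℕ) (e : Env M) (b : M.Num),
    ∃ Y : M.Str, M.le (M.len Y) b ∧
      ∀ a, M.lt a b → (φ.Holds M (e.setN x a) ↔ M.memS a Y)
  comp3 : ∀ φ : Fml, IsSigma0 φ → ∀ (X : SVar) (e : Env M) (b : M.Num),
    ∃ Y : M.Cls, ∀ A : M.Str, M.le (M.len A) b →
      (φ.Holds M (e.setS X A) ↔ M.memC A Y)

/-- `W¹₁ ⊢ φ`: the formula `φ` is a theorem of `W¹₁`, that is, a logical consequence of its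
axioms. -/
def W11Proves (φ : Fml) : Prop :=
  ∀ M : Model3.{u}, M.IsModelW11 → ∀ e : Env M, φ.Holds M e

/-! ### Writing formulas

A `Bld` is a formula in which the names of bound variables are still to be chosen: given `d`,
it uses for them only names `≥ d`. A quantifier takes the name `d` and passes `d + 1` on, so
that no variable is ever captured in a closed formula, which is obtained at `d = 0`. -/

abbrev Bld := ℕ → Fml

def eqB (s t : NTerm) : Bld := fun _ => .eqN s t
def leB (s t : NTerm) : Bld := fun _ => .le s t
def inS (t : NTerm) (X : SVar) : Bld := fun _ => .memS t X
def inC (X : SVar) (C : CVar) : Bld := fun _ => .memC X C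
def notB (φ : Bld) : Bld := fun d => .neg (φ d)
def andB (φ ψ : Bld) : Bld := fun d => .and (φ d) (ψ d)
def orB (φ ψ : Bld) : Bld := fun d => .or (φ d) (ψ d)
def impB (φ ψ : Bld) : Bld := orB (notB φ) ψ
def iffB (φ ψ : Bld) : Bld := andB (impB φ ψ) (impB ψ φ)

infixr:35 " ⩓ " => andB
infixr:30 " ⩔ " => orB
infixr:25 " ⇒ᶠ " => impB
infix:20 " ⇔ᶠ " => iffB

def exNum (f : NTerm → Bld) : Bld := fun d => .exN d (f (.var d) (d + 1))
def allNum (f : NTerm → Bld) : Bld := fun d => .allN d (f (.var d) (d + 1))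
def exStr (f : SVar → Bld) : Bld := fun d => .exS d (f d (d + 1))
def allStr (f : SVar → Bld) : Bld := fun d => .allS d (f d (d + 1))
def exCls (f : CVar → Bld) : Bld := fun d => .exC d (f d (d + 1))

/-- `∃ x < t`, in the form `∃ x ≤ t (x ≠ t ∧ …)`. -/
def exLt (t : NTerm) (f : NTerm → Bld) : Bld :=
  exNum fun x => leB x t ⩓ (notB (eqB x t) ⩓ f x)

/-- `∀ x < t`, in the form `∀ x ≤ t (x ≠ t → …)`. -/
def allLt (t : NTerm) (f : NTerm → Bld) : Bld :=
  allNum fun x => leB x t ⇒ᶠ (notB (eqB x t) ⇒ᶠ f x)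

/-- `∃ X ≤ t`, that is `∃ X (|X| ≤ t ∧ …)`. -/
def exStrLe (t : NTerm) (f : SVar → Bld) : Bld :=
  exStr fun X => leB (.len X) t ⩓ f X

/-- `∀ X ≤ t`, that is `∀ X (|X| ≤ t → …)`. -/
def allStrLe (t : NTerm) (f : SVar → Bld) : Bld :=
  allStr fun X => leB (.len X) t ⇒ᶠ f X

/-- Finite disjunctions; the empty one is false. -/
def bigOr : List Bld → Bld
  | [] => notB (eqB .zero .zero)
  | φ :: L => φ ⩔ bigOr L

/-- The numeral of `k`. -/
def numeral : ℕ → NTerm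
  | 0 => .zero
  | k + 1 => .add (numeral k) .one

/-! ### Pairing -/

/-- The term `(x + y)(x + y + 1) + 2y`, twice the Cantor pair `⟨x, y⟩`. -/
def pair2 (x y : NTerm) : NTerm :=
  .add (.mul (.add x y) (.add (.add x y) .one)) (.add y y)

/-- `z = ⟨x, y⟩`, where `⟨x, y⟩ = (x + y)(x + y + 1) / 2 + y`. -/
def isPair (z x y : NTerm) : Bld := eqB (.add z z) (pair2 x y)

/-- `Z(⟨x, y⟩)`. -/
def mem2 (Z : SVar) (x y : NTerm) : Bld :=
  exLt (.len Z) fun z => isPair z x y ⩓ inS z Z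

/-- `Z(⟨⟨x, y⟩, w⟩)`. -/
def mem3 (Z : SVar) (x y w : NTerm) : Bld :=
  exLt (.len Z) fun z => isPair z x y ⩓ mem2 Z z w

/-- `H(i) = ⟨i, a⟩`, for a function `H` given by its graph. -/
def mapsTo (H : SVar) (i a : NTerm) : Bld :=
  exLt (.len H) fun s => isPair s i a ⩓ mem2 H i s

/-- `z = ⟨i, ⟨i, a⟩⟩`. -/
def isPairPt (z i a : NTerm) : Bld :=
  exNum fun s => leB s z ⩓ (isPair s i a ⩓ isPair z i s)

/-- `H` is (the graph of) a map from the set `V` to the set `W`. -/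
def map (V W H : SVar) : Bld :=
  (allLt (.len H) fun z => inS z H ⇒ᶠ
    exLt (.len V) fun i => exLt (.len W) fun j => inS i V ⩓ inS j W ⩓ isPair z i j) ⩓
  (allLt (.len V) fun i => inS i V ⇒ᶠ
    exLt (.len W) fun j => inS j W ⩓ mem2 H i j ⩓
      allLt (.len W) fun k => mem2 H i k ⇒ᶠ eqB k j)

/-! ### The fixed algebra -/

/-- The operation `Ω` on an `l`-element set is an idempotent special weak near-unanimity
operation. -/
structure IsSpecialWNU {l m : ℕ} (Ω : (Fin m → Fin l) → Fin l) : Prop where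
  idem : ∀ x, Ω (fun _ => x) = x
  wnu : ∀ (x y : Fin l) (i j : Fin m),
    Ω (Function.update (fun _ => x) i y) = Ω (Function.update (fun _ => x) j y)
  special : ∀ (x y : Fin l) (i : Fin m),
    Ω (Function.update (fun _ => x) i (Ω (Function.update (fun _ => x) i y))) =
      Ω (Function.update (fun _ => x) i y)

open Classical in
/-- `Γ¹`: the list of all subuniverses of `(Fin l, Ω)`. -/
noncomputable def gamma1 {l m : ℕ} (Ω : (Fin m → Fin l) → Fin l) : List (Finset (Fin l)) :=
  (Finset.univ.filter fun B : Finset (Fin l) =>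
    ∀ a : Fin m → Fin l, (∀ k, a k ∈ B) → Ω a ∈ B).toList

open Classical in
/-- `Γ²`: the list of all binary relations on `Fin l` compatible with `Ω`. -/
noncomputable def gamma2 {l m : ℕ} (Ω : (Fin m → Fin l) → Fin l) :
    List (Finset (Fin l × Fin l)) :=
  (Finset.univ.filter fun R : Finset (Fin l × Fin l) =>
    ∀ a b : Fin m → Fin l, (∀ k, (a k, b k) ∈ R) → (Ω a, Ω b) ∈ R).toList

/-- `B(a)`, for a fixed set `B`. -/
noncomputable def inSet {l : ℕ} (B : Finset (Fin l)) (a : NTerm) : Bld :=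
  bigOr (B.toList.map fun c => eqB a (numeral c.val))

/-- `R(a, b)`, for a fixed binary relation `R`. -/
noncomputable def inRel {l : ℕ} (R : Finset (Fin l × Fin l)) (a b : NTerm) : Bld :=
  bigOr (R.toList.map fun c => eqB a (numeral c.1.val) ⩓ eqB b (numeral c.2.val))

/-! ### CSP instances -/

/-- An instance `Θ`: the number `n` of variables, the input digraph `(VX, EX)`, and the target
digraph with domains `(VA, EA)`. The variables are the numbers below `n`. -/
structure Inst : Type where
  n : NTerm
  VX : SVar
  EX : SVar
  VA : SVar
  EA : SVar

/-- `a ∈ D_i`. -/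
def Inst.dom (Θ : Inst) (i a : NTerm) : Bld := mem2 Θ.VA i a

/-- `E^{ij}(a, b)`, that is `EA(⟨⟨i, a⟩, ⟨j, b⟩⟩)`. -/
def Inst.rel (Θ : Inst) (i j a b : NTerm) : Bld :=
  exLt (.len Θ.EA) fun s => exLt (.len Θ.EA) fun t =>
    isPair s i a ⩓ isPair t j b ⩓ mem2 Θ.EA s t

/-- A bound on the strings that code maps `i ↦ ⟨i, a⟩` with `i < n`, `a < l`. -/
def Inst.bd (l : ℕ) (Θ : Inst) : NTerm := pair2 Θ.n (pair2 Θ.n (numeral l))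

/-- `DG(Θ)`: the strings have the shape of an input digraph on `n` vertices and of a target
digraph with domains `D_i ⊆ {0, …, l - 1}` and edges `E^{ij} ⊆ D_i × D_j`. -/
def Inst.DG (l : ℕ) (Θ : Inst) : Bld :=
  eqB (.len Θ.VX) Θ.n ⩓
  (allLt Θ.n fun i => inS i Θ.VX) ⩓
  (allLt (.len Θ.EX) fun z => inS z Θ.EX ⇒ᶠ
    exLt Θ.n fun i => exLt Θ.n fun j => isPair z i j) ⩓
  (allLt (.len Θ.VA) fun z => inS z Θ.VA ⇒ᶠ
    exLt Θ.n fun i => exLt (numeral l) fun a => isPair z i a) ⩓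
  (allLt (.len Θ.EA) fun z => inS z Θ.EA ⇒ᶠ
    exLt Θ.n fun i => exLt Θ.n fun j => exLt (numeral l) fun a => exLt (numeral l) fun b =>
      exLt (.len Θ.VA) fun s => exLt (.len Θ.VA) fun t =>
        isPair s i a ⩓ isPair t j b ⩓ isPair z s t ⩓ inS s Θ.VA ⩓ inS t Θ.VA)

/-- `Inst(Θ, Γ)`: `Θ` is a CSP instance over the constraint language `Γ¹ ∪ Γ²` of the fixed
algebra. Every domain is a non-empty subuniverse, every `E^{ij}` is a compatible relation. -/
noncomputable def Inst.isInst {l m : ℕ} (Ω : (Fin m → Fin l) → Fin l) (Θ : Inst) : Bld :=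
  Θ.DG l ⩓
  (allLt Θ.n fun i => exLt (numeral l) fun a => Θ.dom i a) ⩓
  (allLt Θ.n fun i => bigOr ((gamma1 Ω).map fun B =>
    allLt (numeral l) fun a => Θ.dom i a ⇔ᶠ inSet B a)) ⩓
  (allLt Θ.n fun i => allLt Θ.n fun j => bigOr ((gamma2 Ω).map fun R =>
    allLt (numeral l) fun a => allLt (numeral l) fun b => Θ.rel i j a b ⇔ᶠ inRel R a b))

/-- `H ∈ D_0 × … × D_{n-1}`: `H` is a map sending each `i < n` to some `⟨i, a⟩`, `a ∈ D_i`. -/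
def Inst.inProd (l : ℕ) (Θ : Inst) (H : SVar) : Bld :=
  map Θ.VX Θ.VA H ⩓
  (allLt Θ.n fun i => allLt (.len Θ.VA) fun s => mem2 H i s ⇒ᶠ
    exLt (numeral l) fun a => isPair s i a ⩓ Θ.dom i a)

/-- `H ∈ 𝓡_Θ`: `H` is a solution, i.e. a homomorphism from the input digraph to the target
digraph with domains. -/
def Inst.sol (l : ℕ) (Θ : Inst) (H : SVar) : Bld :=
  Θ.inProd l H ⩓
  (allLt Θ.n fun i => allLt Θ.n fun j =>
    allLt (.len Θ.VA) fun s => allLt (.len Θ.VA) fun t =>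
      mem2 Θ.EX i j ⩓ mem2 H i s ⩓ mem2 H j t ⇒ᶠ mem2 Θ.EA s t)

/-- `G` belongs to the relation defined by `Θ(x_0, …, x_{k-1})`: `G` is a map on `{0, …, k-1}`
with `G(i) = ⟨i, a⟩`, `a ∈ D_i`, that extends to a solution of `Θ`; here `k ≤ n`. -/
def Inst.proj (l : ℕ) (Θ : Inst) (k : NTerm) (G : SVar) : Bld :=
  (allLt (.len G) fun z => inS z G ⇒ᶠ
    exLt k fun i => exLt (numeral l) fun a => Θ.dom i a ⩓ isPairPt z i a) ⩓
  (allLt k fun i => exLt (numeral l) fun a => Θ.dom i a ⩓ mapsTo G i a ⩓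
    allLt (numeral l) fun b => mapsTo G i b ⇒ᶠ eqB b a) ⩓
  (exStrLe (Θ.bd l) fun H => Θ.sol l H ⩓
    allLt k fun i => allLt (numeral l) fun a => mapsTo G i a ⇔ᶠ mapsTo H i a)

/-- `Ψ = (ψ_0, …, ψ_{n-1})` is a unary vector function: `Ψ(⟨i, a, b⟩)` says `ψ_i(a) = b`, and
each `ψ_i` is a function from `D_i` to `D_i`. -/
def Inst.vecFun (l : ℕ) (Θ : Inst) (Ψ : SVar) : Bld :=
  (allLt (.len Ψ) fun z => inS z Ψ ⇒ᶠ
    exLt Θ.n fun i => exLt (numeral l) fun a => exLt (numeral l) fun b =>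
      exNum fun s => leB s z ⩓
        (isPair s i a ⩓ isPair z s b ⩓ Θ.dom i a ⩓ Θ.dom i b)) ⩓
  (allLt Θ.n fun i => allLt (numeral l) fun a => Θ.dom i a ⇒ᶠ
    exLt (numeral l) fun b => Θ.dom i b ⩓ mem3 Ψ i a b ⩓
      allLt (numeral l) fun c => mem3 Ψ i a c ⇒ᶠ eqB c b)

/-- `G = H^Ψ`, by the bit-definition: `G` consists of the `⟨i, ⟨i, a⟩⟩` with `i < n`, `a < l`
such that `H(i) = ⟨i, b⟩` and `ψ_i(b) = a` for some `b ∈ D_i`. -/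
def Inst.image (l : ℕ) (Θ : Inst) (Ψ H G : SVar) : Bld :=
  (allLt (.len G) fun z => inS z G ⇒ᶠ
    exLt Θ.n fun i => exLt (numeral l) fun a => isPairPt z i a) ⩓
  (allLt Θ.n fun i => allLt (numeral l) fun a =>
    mapsTo G i a ⇔ᶠ
      exLt (numeral l) fun b => Θ.dom i b ⩓ mapsTo H i b ⩓ mem3 Ψ i b a)

/-- `Ψ ∈ UnPol`: the unary vector function `Ψ` preserves the solution set of `Θ`. -/
def Inst.unPol (l : ℕ) (Θ : Inst) (Ψ : SVar) : Bld :=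
  Θ.vecFun l Ψ ⩓
  (allStrLe (Θ.bd l) fun H => allStrLe (Θ.bd l) fun G =>
    Θ.sol l H ⩓ Θ.image l Ψ H G ⇒ᶠ Θ.sol l G)

/-- A bound on the strings that code unary vector functions. -/
def Inst.bdVec (l : ℕ) (Θ : Inst) : NTerm :=
  pair2 (pair2 Θ.n (numeral l)) (numeral l)

/-- `F` is a homomorphism between the input digraphs of `Θ` and `Λ`. -/
def Inst.hom (Θ Λ : Inst) (F : SVar) : Bld :=
  map Θ.VX Λ.VX F ⩓
  (allLt Θ.n fun i => allLt Θ.n fun j => allLt Λ.n fun k => allLt Λ.n fun p =>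
    mem2 Θ.EX i j ⩓ mem2 F i k ⩓ mem2 F j p ⇒ᶠ mem2 Λ.EX k p)

/-- `Cov(Θ, Λ)`: `Θ` is a covering of `Λ`. There is a homomorphism `F` of input digraphs such
that the domains of `i` and `F(i)` are equal, each constraint `(i, j)` of `Θ` has the same
relation as the constraint `(F(i), F(j))` of `Λ`, and `F(i) = i` for each variable `i`
occurring in both instances. -/
def Inst.cov (l : ℕ) (Θ Λ : Inst) : Bld :=
  exStrLe (pair2 Θ.n Λ.n) fun F => Θ.hom Λ F ⩓
    (allLt Θ.n fun i => allLt Λ.n fun k => mem2 F i k ⇒ᶠ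
      allLt (numeral l) fun a => Θ.dom i a ⇔ᶠ Λ.dom k a) ⩓
    (allLt Θ.n fun i => allLt Θ.n fun j => allLt Λ.n fun k => allLt Λ.n fun p =>
      mem2 Θ.EX i j ⩓ mem2 F i k ⩓ mem2 F j p ⇒ᶠ
        allLt (numeral l) fun a => allLt (numeral l) fun b =>
          Θ.dom i a ⩓ Θ.dom j b ⇒ᶠ (Θ.rel i j a b ⇔ᶠ Λ.rel k p a b)) ⩓
    (allLt Θ.n fun i => allLt Λ.n fun k => eqB i k ⇒ᶠ mem2 F i k)

/-- `C` is the class `{H^Ψ : Ψ ∈ UnPol}` for the solution set of `Λ` (among the strings long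
enough to code all maps from `{0, …, n-1}` to the domains). -/
def Inst.isImages (l : ℕ) (Λ : Inst) (H : SVar) (C : CVar) : Bld :=
  allStrLe (Λ.bd l) fun G =>
    inC G C ⇔ᶠ exStrLe (Λ.bdVec l) fun Ψ => Λ.unPol l Ψ ⩓ Λ.image l Ψ H G

/-- `Θ(x_0, …, x_{k-1})` defines the relation `C` of arity `k`, where `k` is the number of
variables of `Λ`, which all occur in `Θ`. -/
def Inst.defines (l : ℕ) (Θ Λ : Inst) (C : CVar) : Bld :=
  leB Λ.n Θ.n ⩓ allStrLe (Λ.bd l) fun G => inC G C ⇔ᶠ Θ.proj l Λ.n G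

/-- For every instance `Λ` on variables `x_0, …, x_{n-1}` and every `H ∈ D_0 × … × D_{n-1}`
there is the class `C = {H^Ψ : Ψ ∈ UnPol}`, and there is an instance `Υ` that is a covering of
`Λ` such that `Υ(x_0, …, x_{n-1})` defines `C`. -/
noncomputable def coveringFml {l m : ℕ} (Ω : (Fin m → Fin l) → Fin l) : Fml :=
  (allNum fun n => allStr fun VX => allStr fun EX => allStr fun VA => allStr fun EA =>
    allStr fun H =>
      Inst.isInst Ω ⟨n, VX, EX, VA, EA⟩ ⩓ Inst.inProd l ⟨n, VX, EX, VA, EA⟩ H ⇒ᶠ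
      exCls fun C => Inst.isImages l ⟨n, VX, EX, VA, EA⟩ H C ⩓
        exNum fun k => exStr fun VY => exStr fun EY => exStr fun VB => exStr fun EB =>
          Inst.isInst Ω ⟨k, VY, EY, VB, EB⟩ ⩓
          Inst.cov l ⟨k, VY, EY, VB, EB⟩ ⟨n, VX, EX, VA, EA⟩ ⩓
          Inst.defines l ⟨k, VY, EY, VB, EB⟩ ⟨n, VX, EX, VA, EA⟩ C) 0

end BA

namespace BA

/-! ### Arithmetic in models of `W11` -/

/-- Instance-style form of `Model3.IsModelW11`. -/
class W11 (M : Model3.{u}) : Prop where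
  out : M.IsModelW11

variable {M : Model3.{u}}

/-- The assignment given by a list of numbers and a list of strings. -/
noncomputable def envOf (M : Model3.{u}) (xs : List M.Num) (Xs : List M.Str) : Env M where
  num := fun i => xs.getD i M.zero
  str := fun i => Xs.getD i M.str_nonempty.some
  cls := fun _ => M.cls_nonempty.some

theorem W11.induction [W11 M] (φ : Fml) (hφ : IsSigma0 φ) (x : ℕ) (e : Env M) {P : M.Num → Prop}
    (hP : ∀ a, φ.Holds M (e.setN x a) ↔ P a) (h0 : P M.zero)
    (hs : ∀ a, P a → P (M.add a M.one)) (a : M.Num) : P a := by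
  rw [← hP]
  refine W11.out.ind φ (.base hφ) x e ((hP _).2 h0) (fun a ha => ?_) a
  rw [hP] at ha ⊢
  exact hs a ha

namespace W11

theorem zero_add' [W11 M] (a : M.Num) : M.add M.zero a = a := by
  have B := (W11.out (M := M)).basic
  refine induction (.eqN (.add .zero (.var 0)) (.var 0)) (.eqN _ _) 0 (envOf M [] [])
    (P := fun a => M.add M.zero a = a) (fun a => by simp [Fml.Holds, NTerm.val, Env.setN])
    (B.b3 _) (fun a ha => ?_) a
  rw [B.b4, ha]

theorem succ_add' [W11 M] (b a : M.Num) :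
    M.add (M.add b M.one) a = M.add (M.add b a) M.one := by
  have B := (W11.out (M := M)).basic
  refine induction (.eqN (.add (.add (.var 1) .one) (.var 0)) (.add (.add (.var 1) (.var 0)) .one))
    (.eqN _ _) 0 (envOf M [b, b] [])
    (P := fun a => M.add (M.add b M.one) a = M.add (M.add b a) M.one)
    (fun a => by simp [Fml.Holds, NTerm.val, Env.setN, envOf])
    (by rw [B.b3, B.b3]) (fun a ha => ?_) a
  rw [B.b4, ha, B.b4]

theorem add_comm' [W11 M] (b a : M.Num) : M.add b a = M.add a b := by
  have B := (W11.out (M := M)).basic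
  refine induction (.eqN (.add (.var 1) (.var 0)) (.add (.var 0) (.var 1)))
    (.eqN _ _) 0 (envOf M [b, b] []) (P := fun a => M.add b a = M.add a b)
    (fun a => by simp [Fml.Holds, NTerm.val, Env.setN, envOf])
    (by rw [B.b3, zero_add']) (fun a ha => ?_) a
  rw [B.b4, ha, succ_add']

theorem add_assoc' [W11 M] (b c a : M.Num) : M.add (M.add b c) a = M.add b (M.add c a) := by
  have B := (W11.out (M := M)).basic
  refine induction (.eqN (.add (.add (.var 1) (.var 2)) (.var 0))
      (.add (.var 1) (.add (.var 2) (.var 0))))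
    (.eqN _ _) 0 (envOf M [b, b, c] [])
    (P := fun a => M.add (M.add b c) a = M.add b (M.add c a))
    (fun a => by simp [Fml.Holds, NTerm.val, Env.setN, envOf])
    (by rw [B.b3, B.b3]) (fun a ha => ?_) a
  rw [B.b4, ha, B.b4, B.b4]

theorem zero_mul' [W11 M] (a : M.Num) : M.mul M.zero a = M.zero := by
  have B := (W11.out (M := M)).basic
  refine induction (.eqN (.mul .zero (.var 0)) .zero) (.eqN _ _) 0 (envOf M [] [])
    (P := fun a => M.mul M.zero a = M.zero) (fun a => by simp [Fml.Holds, NTerm.val, Env.setN])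
    (B.b5 _) (fun a ha => ?_) a
  rw [B.b6, ha, B.b3]

theorem succ_mul' [W11 M] (b a : M.Num) :
    M.mul (M.add b M.one) a = M.add (M.mul b a) a := by
  have B := (W11.out (M := M)).basic
  refine induction (.eqN (.mul (.add (.var 1) .one) (.var 0))
      (.add (.mul (.var 1) (.var 0)) (.var 0)))
    (.eqN _ _) 0 (envOf M [b, b] [])
    (P := fun a => M.mul (M.add b M.one) a = M.add (M.mul b a) a)
    (fun a => by simp [Fml.Holds, NTerm.val, Env.setN, envOf])
    (by rw [B.b5, B.b5, B.b3]) (fun a ha => ?_) a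
  rw [B.b6, ha, B.b6, add_assoc', add_assoc', B.b4 a, B.b4 b, add_comm' a b]

theorem mul_comm' [W11 M] (b a : M.Num) : M.mul b a = M.mul a b := by
  have B := (W11.out (M := M)).basic
  refine induction (.eqN (.mul (.var 1) (.var 0)) (.mul (.var 0) (.var 1)))
    (.eqN _ _) 0 (envOf M [b, b] []) (P := fun a => M.mul b a = M.mul a b)
    (fun a => by simp [Fml.Holds, NTerm.val, Env.setN, envOf])
    (by rw [B.b5, zero_mul']) (fun a ha => ?_) a
  rw [B.b6, ha, succ_mul']

theorem mul_add' [W11 M] (b c a : M.Num) :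
    M.mul b (M.add c a) = M.add (M.mul b c) (M.mul b a) := by
  have B := (W11.out (M := M)).basic
  refine induction (.eqN (.mul (.var 1) (.add (.var 2) (.var 0)))
      (.add (.mul (.var 1) (.var 2)) (.mul (.var 1) (.var 0))))
    (.eqN _ _) 0 (envOf M [b, b, c] [])
    (P := fun a => M.mul b (M.add c a) = M.add (M.mul b c) (M.mul b a))
    (fun a => by simp [Fml.Holds, NTerm.val, Env.setN, envOf])
    (by rw [B.b3, B.b5, B.b3]) (fun a ha => ?_) a
  rw [B.b4, B.b6, ha, B.b6, add_assoc']

theorem mul_assoc' [W11 M] (b c a : M.Num) : M.mul (M.mul b c) a = M.mul b (M.mul c a) := by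
  have B := (W11.out (M := M)).basic
  refine induction (.eqN (.mul (.mul (.var 1) (.var 2)) (.var 0))
      (.mul (.var 1) (.mul (.var 2) (.var 0))))
    (.eqN _ _) 0 (envOf M [b, b, c] [])
    (P := fun a => M.mul (M.mul b c) a = M.mul b (M.mul c a))
    (fun a => by simp [Fml.Holds, NTerm.val, Env.setN, envOf])
    (by rw [B.b5, B.b5, B.b5]) (fun a ha => ?_) a
  rw [B.b6, ha, B.b6, mul_add']

theorem add_right_cancel' [W11 M] (b c a : M.Num) : M.add b a = M.add c a → b = c := by
  have B := (W11.out (M := M)).basic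
  refine induction (.or (.neg (.eqN (.add (.var 1) (.var 0)) (.add (.var 2) (.var 0))))
      (.eqN (.var 1) (.var 2)))
    (.or (.neg (.eqN _ _)) (.eqN _ _)) 0 (envOf M [b, b, c] [])
    (P := fun a => M.add b a = M.add c a → b = c)
    (fun a => by simp [Fml.Holds, NTerm.val, Env.setN, envOf, imp_iff_not_or])
    (by rw [B.b3, B.b3]; exact id) (fun a ha h => ?_) a
  rw [B.b4, B.b4] at h
  exact ha (B.b2 _ _ h)

theorem exists_add_of_le' [W11 M] (b a : M.Num) : M.le b a → ∃ c, M.le c a ∧ M.add b c = a := by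
  have B := (W11.out (M := M)).basic
  refine induction (.or (.neg (.le (.var 1) (.var 0)))
      (.exN 2 (.and (.le (.var 2) (.var 0)) (.eqN (.add (.var 1) (.var 2)) (.var 0)))))
    (.or (.neg (.le _ _)) (.exN (by simp [NTerm.OccN]) (.eqN _ _))) 0 (envOf M [b, b] [])
    (P := fun a => M.le b a → ∃ c, M.le c a ∧ M.add b c = a)
    (fun a => by simp [Fml.Holds, NTerm.val, Env.setN, envOf, imp_iff_not_or])
    (fun h => ⟨M.zero, B.b9 _, by rw [B.b3]; exact B.b7 _ _ h (B.b9 _)⟩) (fun a ha h => ?_) a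
  by_cases hb : b = M.add a M.one
  · exact ⟨M.zero, B.b9 _, by rw [B.b3, hb]⟩
  · obtain ⟨c, -, hc⟩ := ha ((B.b11 _ _).2 ⟨h, hb⟩)
    refine ⟨M.add c M.one, ?_, by rw [B.b4, hc]⟩
    rw [← hc, add_assoc', add_comm' b]
    exact B.b8 _ _

end W11

instance : Zero M.Num := ⟨M.zero⟩
instance : One M.Num := ⟨M.one⟩
instance : Add M.Num := ⟨M.add⟩
instance : Mul M.Num := ⟨M.mul⟩
instance : LE M.Num := ⟨M.le⟩
instance : Membership M.Num M.Str := ⟨fun X a => M.memS a X⟩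
instance : Membership M.Str M.Cls := ⟨fun C X => M.memC X C⟩

section
open W11

noncomputable instance [W11 M] : CommSemiring M.Num where
  add_assoc := add_assoc'
  zero_add := zero_add'
  add_zero := (W11.out (M := M)).basic.b3
  add_comm := add_comm'
  nsmul := nsmulRec
  mul_assoc := W11.mul_assoc'
  mul_comm := W11.mul_comm'
  left_distrib := mul_add'
  right_distrib a b c := by
    change M.mul (M.add a b) c = M.add (M.mul a c) (M.mul b c)
    rw [W11.mul_comm', mul_add', W11.mul_comm' c, W11.mul_comm' c]
  zero_mul := zero_mul'
  mul_zero := (W11.out (M := M)).basic.b5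
  one_mul a := by
    change M.mul M.one a = a
    rw [← zero_add' M.one, succ_mul', zero_mul', zero_add']
  mul_one a := by
    change M.mul a M.one = a
    rw [← zero_add' M.one, (W11.out (M := M)).basic.b6, (W11.out (M := M)).basic.b5, zero_add']

theorem W11.le_add [W11 M] (a b : M.Num) : a ≤ a + b := (W11.out (M := M)).basic.b8 a b

theorem W11.exists_add [W11 M] {a b : M.Num} (h : a ≤ b) : ∃ c, b = a + c :=
  let ⟨c, _, hc⟩ := exists_add_of_le' a b h
  ⟨c, hc.symm⟩

open Classical in
noncomputable instance [W11 M] : LinearOrder M.Num where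
  le_refl a := by simpa using W11.le_add a 0
  le_trans a b c h k := by
    obtain ⟨x, rfl⟩ := W11.exists_add h
    obtain ⟨y, rfl⟩ := W11.exists_add k
    rw [add_assoc]
    exact W11.le_add _ _
  le_antisymm := (W11.out (M := M)).basic.b7
  le_total := (W11.out (M := M)).basic.b10
  toDecidableLE := fun _ _ => Classical.propDecidable _

instance [W11 M] : IsCancelAdd M.Num where
  add_left_cancel a b c h := add_right_cancel' b c a (by
    change b + a = c + a
    rw [add_comm b, add_comm c]; exact h)
  add_right_cancel a b c h := add_right_cancel' b c a h

instance [W11 M] : IsOrderedAddMonoid M.Num where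
  add_le_add_left a b h c := by
    obtain ⟨x, rfl⟩ := W11.exists_add h
    rw [add_right_comm]
    exact W11.le_add _ _

instance [W11 M] : CanonicallyOrderedAdd M.Num where
  exists_add_of_le h := W11.exists_add h
  le_add_self a b := by rw [add_comm]; exact W11.le_add _ _
  le_self_add a b := W11.le_add _ _

instance [W11 M] : IsOrderedCancelAddMonoid M.Num where
  le_of_add_le_add_left a b c h := by
    obtain ⟨x, hx⟩ := W11.exists_add h
    rw [add_assoc] at hx
    rw [add_left_cancel hx]
    exact W11.le_add _ _

instance [W11 M] : IsOrderedRing M.Num := CanonicallyOrderedAdd.toIsOrderedRing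

theorem W11.lt_add_one_iff [W11 M] {a b : M.Num} : a < b + 1 ↔ a ≤ b := by
  rw [lt_iff_le_and_ne]
  exact ((W11.out (M := M)).basic.b11 a b).symm

theorem W11.add_one_le_iff [W11 M] {a b : M.Num} : a + 1 ≤ b ↔ a < b := by
  rw [← W11.lt_add_one_iff, add_lt_add_iff_right]

end

@[simp] theorem add_def [W11 M] (a b : M.Num) : M.add a b = a + b := rfl
@[simp] theorem mul_def [W11 M] (a b : M.Num) : M.mul a b = a * b := rfl
@[simp] theorem zero_def [W11 M] : M.zero = 0 := rfl
@[simp] theorem one_def [W11 M] : M.one = 1 := rfl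
@[simp] theorem le_def [W11 M] (a b : M.Num) : M.le a b ↔ a ≤ b := Iff.rfl
@[simp] theorem lt_def [W11 M] (a b : M.Num) : M.lt a b ↔ a < b :=
  (lt_iff_le_and_ne (a := a) (b := b)).symm

theorem lt_len [W11 M] {a : M.Num} {X : M.Str} (h : a ∈ X) : a < M.len X :=
  (lt_def _ _).1 ((W11.out (M := M)).basic.l1 X a h)

/-- A string whose elements are exactly the numbers below `b` has length `b`. -/
theorem len_eq [W11 M] {X : M.Str} {b : M.Num} (h : M.len X ≤ b) (hX : ∀ a < b, a ∈ X) :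
    M.len X = b :=
  h.eq_of_not_lt fun h => (lt_len (hX _ h)).false

/-! ### Pairing in models -/

/-- Twice the Cantor pair. -/
def dblPr (x y : M.Num) : M.Num := (x + y) * (x + y + 1) + (y + y)

theorem dblPr_mono [W11 M] {x y x' y' : M.Num} (hx : x ≤ x') (hy : y ≤ y') :
    dblPr x y ≤ dblPr x' y' := by
  unfold dblPr
  gcongr

theorem dblPr_lt [W11 M] {x y x' y' : M.Num} (h : x + y < x' + y') : dblPr x y < dblPr x' y' := by
  have h1 : x + y + 1 ≤ x' + y' := W11.add_one_le_iff.2 h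
  calc dblPr x y ≤ (x + y) * (x + y + 1) + ((x + y) + (x + y)) := by
        unfold dblPr
        have : y ≤ x + y := le_add_self
        gcongr
    _ < (x + y) * (x + y + 1) + ((x + y) + (x + y)) + 1 := W11.lt_add_one_iff.2 le_rfl
    _ ≤ (x + y) * (x + y + 1) + ((x + y) + (x + y)) + 1 + 1 := le_self_add
    _ = (x + y + 1) * (x + y + 1 + 1) := by ring
    _ ≤ (x' + y') * (x' + y' + 1) := by gcongr
    _ ≤ dblPr x' y' := le_self_add

theorem dbl_inj [W11 M] {x y : M.Num} (h : x + x = y + y) : x = y := by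
  rcases lt_trichotomy x y with hl | he | hl
  · exact absurd h (add_lt_add hl hl).ne
  · exact he
  · exact absurd h (add_lt_add hl hl).ne'

theorem dblPr_inj [W11 M] {x y x' y' : M.Num} (h : dblPr x y = dblPr x' y') :
    x = x' ∧ y = y' := by
  have hs : x + y = x' + y' := by
    rcases lt_trichotomy (x + y) (x' + y') with hl | he | hl
    · exact absurd h (dblPr_lt hl).ne
    · exact he
    · exact absurd h (dblPr_lt hl).ne'
  unfold dblPr at h
  rw [hs] at h
  have hy : y = y' := dbl_inj (add_left_cancel h)
  subst hy
  exact ⟨add_right_cancel hs, rfl⟩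

theorem exists_half [W11 M] (a : M.Num) : ∃ z, z ≤ a * (a + 1) ∧ z + z = a * (a + 1) := by
  refine W11.induction (.exN 1 (.and (.le (.var 1) (.mul (.var 0) (.add (.var 0) .one)))
      (.eqN (.add (.var 1) (.var 1)) (.mul (.var 0) (.add (.var 0) .one)))))
    (.exN (by simp [NTerm.OccN]) (.eqN _ _)) 0 (envOf M [] [])
    (P := fun a => ∃ z, z ≤ a * (a + 1) ∧ z + z = a * (a + 1))
    (fun a => by simp [Fml.Holds, NTerm.val, Env.setN]) ⟨0, by simp⟩ ?_ a
  rintro a ⟨z, -, hz⟩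
  have h : (z + (a + 1)) + (z + (a + 1)) = (a + 1) * (a + 1 + 1) := by
    calc _ = (z + z) + ((a + 1) + (a + 1)) := by ring
      _ = _ := by rw [hz]; ring
  exact ⟨z + (a + 1), by simp only [add_def, one_def]; rw [← h]; exact le_self_add, h⟩

theorem exists_pr [W11 M] (x y : M.Num) : ∃ z, z + z = dblPr x y := by
  obtain ⟨z, -, hz⟩ := exists_half (x + y)
  exact ⟨z + y, by rw [dblPr, ← hz]; ring⟩

/-- The Cantor pair. -/
noncomputable def pr [W11 M] (x y : M.Num) : M.Num := (exists_pr x y).choose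

theorem pr_add_pr [W11 M] (x y : M.Num) : pr x y + pr x y = dblPr x y := (exists_pr x y).choose_spec

theorem dbl_eq_dblPr [W11 M] {x y z : M.Num} : z + z = dblPr x y ↔ z = pr x y := by
  rw [← pr_add_pr]
  exact ⟨dbl_inj, fun h => by rw [h]⟩

@[simp] theorem pr_inj [W11 M] {x y x' y' : M.Num} : pr x y = pr x' y' ↔ x = x' ∧ y = y' :=
  ⟨fun h => dblPr_inj (by rw [← pr_add_pr, ← pr_add_pr, h]), fun h => by rw [h.1, h.2]⟩

theorem right_le_pr [W11 M] (x y : M.Num) : y ≤ pr x y := by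
  by_contra! h
  have := add_lt_add h h
  rw [pr_add_pr] at this
  exact this.not_ge le_add_self

theorem left_le_pr [W11 M] (x y : M.Num) : x ≤ pr x y := by
  by_contra! h
  have hx : 1 ≤ x := by
    simpa using W11.add_one_le_iff.2 (zero_le.trans_lt h)
  have h2 := add_lt_add h h
  rw [pr_add_pr] at h2
  refine h2.not_ge ?_
  calc x + x ≤ x * x + x := by gcongr; simpa using mul_le_mul_right hx x
    _ = (x + 0) * (x + 0 + 1) := by ring
    _ ≤ (x + y) * (x + y + 1) := by gcongr <;> exact zero_le
    _ ≤ dblPr x y := le_self_add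

theorem pr_lt_dblPr [W11 M] {x y x' y' : M.Num} (hx : x < x') (hy : y ≤ y') :
    pr x y < dblPr x' y' :=
  calc pr x y ≤ pr x y + pr x y := le_self_add
    _ = dblPr x y := pr_add_pr _ _
    _ < _ := dblPr_lt (add_lt_add_of_lt_of_le hx hy)

end BA

namespace BA

/-! ### Freshness -/

/-- The name `X` is less than `d`. -/
class VBelow (X d : ℕ) : Prop where
  lt : X < d

/-- All variables of the term have names less than `d`. -/
class NTerm.Below (t : NTerm) (d : ℕ) : Prop where
  num : ∀ x, t.OccN x → x < d
  str : ∀ X, t.OccS X → X < d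

instance (d : ℕ) : VBelow d (d + 1) := ⟨d.lt_succ_self⟩

instance (X d : ℕ) [h : VBelow X d] : VBelow X (d + 1) := ⟨h.lt.trans d.lt_succ_self⟩

instance (t : NTerm) (d : ℕ) [h : t.Below d] : t.Below (d + 1) :=
  ⟨fun x hx => (h.num x hx).trans d.lt_succ_self, fun x hx => (h.str x hx).trans d.lt_succ_self⟩

instance (x d : ℕ) [h : VBelow x d] : (NTerm.var x).Below d :=
  ⟨fun y hy => by cases hy; exact h.lt, fun _ h => h.elim⟩

instance (X d : ℕ) [h : VBelow X d] : (NTerm.len X).Below d :=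
  ⟨fun _ h => h.elim, fun y hy => by cases hy; exact h.lt⟩

instance (d : ℕ) : NTerm.zero.Below d := ⟨fun _ h => h.elim, fun _ h => h.elim⟩

instance (d : ℕ) : NTerm.one.Below d := ⟨fun _ h => h.elim, fun _ h => h.elim⟩

instance (s t : NTerm) (d : ℕ) [hs : s.Below d] [ht : t.Below d] : (s.add t).Below d :=
  ⟨fun x h => h.elim (hs.num x) (ht.num x), fun x h => h.elim (hs.str x) (ht.str x)⟩

instance (s t : NTerm) (d : ℕ) [hs : s.Below d] [ht : t.Below d] : (s.mul t).Below d :=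
  ⟨fun x h => h.elim (hs.num x) (ht.num x), fun x h => h.elim (hs.str x) (ht.str x)⟩

instance (s t : NTerm) (d : ℕ) [s.Below d] [t.Below d] : (pair2 s t).Below d := by
  unfold pair2; infer_instance

instance numeral_below (k d : ℕ) : (numeral k).Below d := by
  induction k with
  | zero => unfold numeral; infer_instance
  | succ k ih => unfold numeral; infer_instance

/-- All variables of the instance have names less than `d`. -/
class Inst.Below (Θ : Inst) (d : ℕ) : Prop where
  n : Θ.n.Below d
  VX : VBelow Θ.VX d
  EX : VBelow Θ.EX d
  VA : VBelow Θ.VA d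
  EA : VBelow Θ.EA d

instance (Θ : Inst) (d : ℕ) [h : Θ.Below d] : Θ.n.Below d := h.n
instance (Θ : Inst) (d : ℕ) [h : Θ.Below d] : VBelow Θ.VX d := h.VX
instance (Θ : Inst) (d : ℕ) [h : Θ.Below d] : VBelow Θ.EX d := h.EX
instance (Θ : Inst) (d : ℕ) [h : Θ.Below d] : VBelow Θ.VA d := h.VA
instance (Θ : Inst) (d : ℕ) [h : Θ.Below d] : VBelow Θ.EA d := h.EA

instance (n : NTerm) (VX EX VA EA d : ℕ) [h1 : n.Below d] [h2 : VBelow VX d] [h3 : VBelow EX d]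
    [h4 : VBelow VA d] [h5 : VBelow EA d] : Inst.Below ⟨n, VX, EX, VA, EA⟩ d :=
  ⟨h1, h2, h3, h4, h5⟩

instance (Θ : Inst) (d : ℕ) [h : Θ.Below d] : Θ.Below (d + 1) :=
  ⟨inferInstance, inferInstance, inferInstance, inferInstance, inferInstance⟩

instance (l : ℕ) (Θ : Inst) (d : ℕ) [Θ.Below d] : (Θ.bd l).Below d := by
  unfold Inst.bd; infer_instance

instance (l : ℕ) (Θ : Inst) (d : ℕ) [Θ.Below d] : (Θ.bdVec l).Below d := by
  unfold Inst.bdVec; infer_instance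

/-! ### Evaluation under changes of the assignment -/

variable {M : Model3.{u}} (e : Env M) (d : ℕ)

theorem NTerm.val_congr {e e' : Env M} (t : NTerm)
    (hn : ∀ x, t.OccN x → e.num x = e'.num x) (hs : ∀ x, t.OccS x → e.str x = e'.str x) :
    t.val M e = t.val M e' := by
  induction t with
  | var x => exact hn x rfl
  | len x => exact congrArg M.len (hs x rfl)
  | zero => rfl
  | one => rfl
  | add s t ihs iht =>
    exact congrArg₂ M.add (ihs (fun x h => hn x (.inl h)) fun x h => hs x (.inl h))
      (iht (fun x h => hn x (.inr h)) fun x h => hs x (.inr h))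
  | mul s t ihs iht =>
    exact congrArg₂ M.mul (ihs (fun x h => hn x (.inl h)) fun x h => hs x (.inl h))
      (iht (fun x h => hn x (.inr h)) fun x h => hs x (.inr h))

@[simp] theorem val_setN (t : NTerm) [h : t.Below d] (a : M.Num) :
    t.val M (e.setN d a) = t.val M e :=
  t.val_congr (fun x hx => Function.update_of_ne (h.num x hx).ne _ _) fun _ _ => rfl

@[simp] theorem val_setS (t : NTerm) [h : t.Below d] (A : M.Str) :
    t.val M (e.setS d A) = t.val M e :=
  t.val_congr (fun _ _ => rfl) fun x hx => Function.update_of_ne (h.str x hx).ne _ _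

@[simp] theorem val_setC (t : NTerm) (A : M.Cls) : t.val M (e.setC d A) = t.val M e :=
  t.val_congr (fun _ _ => rfl) fun _ _ => rfl

@[simp] theorem val_var_setN (a : M.Num) : (NTerm.var d).val M (e.setN d a) = a :=
  Function.update_self ..

@[simp] theorem str_setN (X : SVar) (a : M.Num) : (e.setN d a).str X = e.str X := rfl

@[simp] theorem str_setS_self (A : M.Str) : (e.setS d A).str d = A := Function.update_self ..

@[simp] theorem str_setS (X : SVar) [h : VBelow X d] (A : M.Str) :
    (e.setS d A).str X = e.str X := Function.update_of_ne h.lt.ne _ _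

@[simp] theorem str_setC (X : SVar) (A : M.Cls) : (e.setC d A).str X = e.str X := rfl

@[simp] theorem cls_setN (X : CVar) (a : M.Num) : (e.setN d a).cls X = e.cls X := rfl

@[simp] theorem cls_setS (X : CVar) (A : M.Str) : (e.setS d A).cls X = e.cls X := rfl

@[simp] theorem cls_setC_self (A : M.Cls) : (e.setC d A).cls d = A := Function.update_self ..

@[simp] theorem val_len (X : SVar) : (NTerm.len X).val M e = M.len (e.str X) := rfl

@[simp] theorem val_one [W11 M] : NTerm.one.val M e = 1 := rfl

@[simp] theorem val_add [W11 M] (s t : NTerm) :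
    (s.add t).val M e = s.val M e + t.val M e := rfl

@[simp] theorem val_mul [W11 M] (s t : NTerm) :
    (s.mul t).val M e = s.val M e * t.val M e := rfl

@[simp] theorem val_pair2 [W11 M] (s t : NTerm) :
    (pair2 s t).val M e = dblPr (s.val M e) (t.val M e) := rfl

@[simp] theorem val_numeral [W11 M] (k : ℕ) : (numeral k).val M e = (k : M.Num) := by
  induction k with
  | zero => exact Nat.cast_zero.symm
  | succ k ih =>
    rw [Nat.cast_succ, ← ih]
    rfl

/-! ### The meaning of the formula builders -/

section holds

variable (s t x y z w : NTerm) (X V W H F : SVar) (C : CVar) (φ ψ : Bld) (f : NTerm → Bld)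
  (g : ℕ → Bld)

@[simp] theorem holds_eqB : (eqB s t d).Holds M e ↔ s.val M e = t.val M e := Iff.rfl
@[simp] theorem holds_leB [W11 M] : (leB s t d).Holds M e ↔ s.val M e ≤ t.val M e := Iff.rfl
@[simp] theorem holds_inS : (inS t X d).Holds M e ↔ t.val M e ∈ e.str X := Iff.rfl
@[simp] theorem holds_inC : (inC X C d).Holds M e ↔ e.str X ∈ e.cls C := Iff.rfl
@[simp] theorem holds_notB : (notB φ d).Holds M e ↔ ¬ (φ d).Holds M e := Iff.rfl
@[simp] theorem holds_andB : ((φ ⩓ ψ) d).Holds M e ↔ (φ d).Holds M e ∧ (ψ d).Holds M e := Iff.rfl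
@[simp] theorem holds_orB : ((φ ⩔ ψ) d).Holds M e ↔ (φ d).Holds M e ∨ (ψ d).Holds M e := Iff.rfl

@[simp] theorem holds_impB :
    ((φ ⇒ᶠ ψ) d).Holds M e ↔ ((φ d).Holds M e → (ψ d).Holds M e) := imp_iff_not_or.symm

@[simp] theorem holds_iffB :
    ((φ ⇔ᶠ ψ) d).Holds M e ↔ ((φ d).Holds M e ↔ (ψ d).Holds M e) := by
  simp [iffB, iff_iff_implies_and_implies]

@[simp] theorem holds_exNum :
    (exNum f d).Holds M e ↔ ∃ a, (f (.var d) (d + 1)).Holds M (e.setN d a) := Iff.rfl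

@[simp] theorem holds_allNum :
    (allNum f d).Holds M e ↔ ∀ a, (f (.var d) (d + 1)).Holds M (e.setN d a) := Iff.rfl

@[simp] theorem holds_exStr :
    (exStr g d).Holds M e ↔ ∃ A, (g d (d + 1)).Holds M (e.setS d A) := Iff.rfl

@[simp] theorem holds_allStr :
    (allStr g d).Holds M e ↔ ∀ A, (g d (d + 1)).Holds M (e.setS d A) := Iff.rfl

@[simp] theorem holds_exCls :
    (exCls g d).Holds M e ↔ ∃ A, (g d (d + 1)).Holds M (e.setC d A) := Iff.rfl

@[simp] theorem holds_exLt [W11 M] [t.Below d] :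
    (exLt t f d).Holds M e ↔
      ∃ a, a < t.val M e ∧ (f (.var d) (d + 1)).Holds M (e.setN d a) := by
  simp [exLt, lt_iff_le_and_ne, and_assoc]

@[simp] theorem holds_allLt [W11 M] [t.Below d] :
    (allLt t f d).Holds M e ↔
      ∀ a, a < t.val M e → (f (.var d) (d + 1)).Holds M (e.setN d a) := by
  simp [allLt, lt_iff_le_and_ne]

@[simp] theorem holds_exStrLe [W11 M] [t.Below d] :
    (exStrLe t g d).Holds M e ↔
      ∃ A, M.len A ≤ t.val M e ∧ (g d (d + 1)).Holds M (e.setS d A) := by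
  simp [exStrLe]

@[simp] theorem holds_allStrLe [W11 M] [t.Below d] :
    (allStrLe t g d).Holds M e ↔
      ∀ A, M.len A ≤ t.val M e → (g d (d + 1)).Holds M (e.setS d A) := by
  simp [allStrLe]

@[simp] theorem holds_bigOr (L : List Bld) :
    (bigOr L d).Holds M e ↔ ∃ β ∈ L, (β d).Holds M e := by
  induction L with
  | nil => simp [bigOr]
  | cons β L ih => simp [bigOr, ih]

variable [W11 M]

@[simp] theorem holds_isPair :
    (isPair z x y d).Holds M e ↔ z.val M e = pr (x.val M e) (y.val M e) := dbl_eq_dblPr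

@[simp] theorem holds_inSet {l : ℕ} (B : Finset (Fin l)) :
    (inSet B x d).Holds M e ↔ ∃ c ∈ B, x.val M e = (c.val : M.Num) := by
  simp [inSet]

@[simp] theorem holds_inRel {l : ℕ} (R : Finset (Fin l × Fin l)) :
    (inRel R x y d).Holds M e ↔
      ∃ c ∈ R, x.val M e = (c.1.val : M.Num) ∧ y.val M e = (c.2.val : M.Num) := by
  simp [inRel]

variable [x.Below d] [y.Below d] [z.Below d] [w.Below d] [VBelow X d] [VBelow V d] [VBelow W d]
  [VBelow H d] [VBelow F d]

@[simp] theorem holds_mem2 :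
    (mem2 X x y d).Holds M e ↔ pr (x.val M e) (y.val M e) ∈ e.str X := by
  simp only [mem2, holds_exLt, holds_andB, holds_isPair, holds_inS, val_var_setN, val_setN,
    val_len, str_setN]
  exact ⟨fun ⟨a, _, h, h'⟩ => h ▸ h', fun h => ⟨_, lt_len h, rfl, h⟩⟩

@[simp] theorem holds_mem3 :
    (mem3 X x y w d).Holds M e ↔ pr (pr (x.val M e) (y.val M e)) (w.val M e) ∈ e.str X := by
  simp only [mem3, holds_exLt, holds_andB, holds_isPair, holds_mem2, val_var_setN, val_setN,
    val_len, str_setN]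
  exact ⟨fun ⟨a, _, h, h'⟩ => h ▸ h', fun h => ⟨_, (left_le_pr _ _).trans_lt (lt_len h), rfl, h⟩⟩

@[simp] theorem holds_mapsTo :
    (mapsTo H x y d).Holds M e ↔
      pr (x.val M e) (pr (x.val M e) (y.val M e)) ∈ e.str H := by
  simp only [mapsTo, holds_exLt, holds_andB, holds_isPair, holds_mem2, val_var_setN, val_setN,
    val_len, str_setN]
  exact ⟨fun ⟨a, _, h, h'⟩ => h ▸ h', fun h => ⟨_, (right_le_pr _ _).trans_lt (lt_len h), rfl, h⟩⟩

@[simp] theorem holds_isPairPt :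
    (isPairPt z x y d).Holds M e ↔
      z.val M e = pr (x.val M e) (pr (x.val M e) (y.val M e)) := by
  simp only [isPairPt, holds_exNum, holds_leB, holds_andB, holds_isPair, val_var_setN, val_setN]
  exact ⟨fun ⟨a, _, h, h'⟩ => h ▸ h', fun h => ⟨_, h ▸ right_le_pr _ _, rfl, h⟩⟩

/-- The set `H` is the graph of a map from the set `V` to the set `W`. -/
def IsMap (V W H : M.Str) : Prop :=
  (∀ z ∈ H, ∃ i ∈ V, ∃ j ∈ W, z = pr i j) ∧
  ∀ i ∈ V, ∃ j ∈ W, pr i j ∈ H ∧ ∀ k, pr i k ∈ H → k = j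

@[simp] theorem holds_map :
    (map V W H d).Holds M e ↔ IsMap (e.str V) (e.str W) (e.str H) := by
  simp only [map, holds_exLt, holds_allLt, holds_andB, holds_isPair, holds_mem2, val_var_setN,
    val_setN, val_len, str_setN, holds_impB, holds_inS, holds_eqB]
  constructor
  · rintro ⟨h1, h2⟩
    have h1' : ∀ z ∈ e.str H, ∃ i ∈ e.str V, ∃ j ∈ e.str W, z = pr i j := fun z hz =>
      let ⟨i, _, j, _, hi, hj, h⟩ := h1 z (lt_len hz) hz
      ⟨i, hi, j, hj, h⟩
    refine ⟨h1', fun i hi => ?_⟩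
    obtain ⟨j, _, hj, h, hu⟩ := h2 i (lt_len hi) hi
    refine ⟨j, hj, h, fun k hk => hu k ?_ hk⟩
    obtain ⟨i', _, j', hj', he⟩ := h1' _ hk
    obtain ⟨-, rfl⟩ := pr_inj.1 he
    exact lt_len hj'
  · rintro ⟨h1, h2⟩
    refine ⟨fun z _ hz => ?_, fun i _ hi => ?_⟩
    · obtain ⟨i, hi, j, hj, h⟩ := h1 z hz
      exact ⟨i, lt_len hi, j, lt_len hj, hi, hj, h⟩
    · obtain ⟨j, hj, h, hu⟩ := h2 i hi
      exact ⟨j, lt_len hj, hj, h, fun k _ => hu k⟩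

end holds

/-! ### Instances in models -/

/-- The values of the five components of an instance. -/
structure SInst (M : Model3.{u}) : Type u where
  n : M.Num
  VX : M.Str
  EX : M.Str
  VA : M.Str
  EA : M.Str

/-- The value of an instance. -/
def Inst.val (Θ : Inst) (e : Env M) : SInst M :=
  ⟨Θ.n.val M e, e.str Θ.VX, e.str Θ.EX, e.str Θ.VA, e.str Θ.EA⟩

section

variable (Θ Λ : Inst)

@[simp] theorem Inst.val_n : (Θ.val e).n = Θ.n.val M e := rfl
@[simp] theorem Inst.val_VX : (Θ.val e).VX = e.str Θ.VX := rfl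
@[simp] theorem Inst.val_EX : (Θ.val e).EX = e.str Θ.EX := rfl
@[simp] theorem Inst.val_VA : (Θ.val e).VA = e.str Θ.VA := rfl
@[simp] theorem Inst.val_EA : (Θ.val e).EA = e.str Θ.EA := rfl

@[simp] theorem Inst.val_setN [Θ.Below d] (a : M.Num) : Θ.val (e.setN d a) = Θ.val e := by
  simp [Inst.val]

@[simp] theorem Inst.val_setS [Θ.Below d] (A : M.Str) : Θ.val (e.setS d A) = Θ.val e := by
  simp [Inst.val]

end

namespace SInst

variable [W11 M] (I J : SInst M) (l : ℕ)

def Dom (i a : M.Num) : Prop := pr i a ∈ I.VA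

def Rel (i j a b : M.Num) : Prop := pr (pr i a) (pr j b) ∈ I.EA

noncomputable def bound : M.Num := dblPr I.n (dblPr I.n l)

noncomputable def vecBound : M.Num := dblPr (dblPr I.n l) l

structure Digraphs : Prop where
  len_VX : M.len I.VX = I.n
  mem_VX : ∀ i < I.n, i ∈ I.VX
  mem_EX : ∀ z ∈ I.EX, ∃ i < I.n, ∃ j < I.n, z = pr i j
  mem_VA : ∀ z ∈ I.VA, ∃ i < I.n, ∃ a < (l : M.Num), z = pr i a
  mem_EA : ∀ z ∈ I.EA, ∃ i < I.n, ∃ j < I.n, ∃ a < (l : M.Num), ∃ b < (l : M.Num),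
    z = pr (pr i a) (pr j b) ∧ I.Dom i a ∧ I.Dom j b

structure IsInst {l m : ℕ} (Ω : (Fin m → Fin l) → Fin l) : Prop extends I.Digraphs l where
  exists_dom : ∀ i < I.n, ∃ a < (l : M.Num), I.Dom i a
  dom_mem : ∀ i < I.n, ∃ B ∈ gamma1 Ω, ∀ a < (l : M.Num),
    (I.Dom i a ↔ ∃ c ∈ B, a = (c.val : M.Num))
  rel_mem : ∀ i < I.n, ∀ j < I.n, ∃ R ∈ gamma2 Ω, ∀ a < (l : M.Num), ∀ b < (l : M.Num),
    (I.Rel i j a b ↔ ∃ c ∈ R, a = (c.1.val : M.Num) ∧ b = (c.2.val : M.Num))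

/-- `H(i) = ⟨i, a⟩`. -/
def _root_.BA.Maps (H : M.Str) (i a : M.Num) : Prop := pr i (pr i a) ∈ H

def InProd (H : M.Str) : Prop :=
  IsMap I.VX I.VA H ∧
  ∀ i < I.n, ∀ s < M.len I.VA, pr i s ∈ H → ∃ a < (l : M.Num), s = pr i a ∧ I.Dom i a

def Sol (H : M.Str) : Prop :=
  I.InProd l H ∧ ∀ i < I.n, ∀ j < I.n, ∀ s < M.len I.VA, ∀ t < M.len I.VA,
    pr i j ∈ I.EX ∧ pr i s ∈ H ∧ pr j t ∈ H → pr s t ∈ I.EA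

def Proj (k : M.Num) (G : M.Str) : Prop :=
  (∀ z ∈ G, ∃ i < k, ∃ a < (l : M.Num), I.Dom i a ∧ z = pr i (pr i a)) ∧
  (∀ i < k, ∃ a < (l : M.Num), I.Dom i a ∧ Maps G i a ∧ ∀ b < (l : M.Num), Maps G i b → b = a) ∧
  ∃ H, M.len H ≤ I.bound l ∧ I.Sol l H ∧
    ∀ i < k, ∀ a < (l : M.Num), Maps G i a ↔ Maps H i a

def VecFun (Ψ : M.Str) : Prop :=
  (∀ z ∈ Ψ, ∃ i < I.n, ∃ a < (l : M.Num), ∃ b < (l : M.Num),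
    z = pr (pr i a) b ∧ I.Dom i a ∧ I.Dom i b) ∧
  ∀ i < I.n, ∀ a < (l : M.Num), I.Dom i a →
    ∃ b < (l : M.Num), I.Dom i b ∧ pr (pr i a) b ∈ Ψ ∧
      ∀ c < (l : M.Num), pr (pr i a) c ∈ Ψ → c = b

def Image (Ψ H G : M.Str) : Prop :=
  (∀ z ∈ G, ∃ i < I.n, ∃ a < (l : M.Num), z = pr i (pr i a)) ∧
  ∀ i < I.n, ∀ a < (l : M.Num),
    Maps G i a ↔ ∃ b < (l : M.Num), I.Dom i b ∧ Maps H i b ∧ pr (pr i b) a ∈ Ψ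

def UnPol (Ψ : M.Str) : Prop :=
  I.VecFun l Ψ ∧ ∀ H, M.len H ≤ I.bound l → ∀ G, M.len G ≤ I.bound l →
    I.Sol l H ∧ I.Image l Ψ H G → I.Sol l G

def Hom (F : M.Str) : Prop :=
  IsMap I.VX J.VX F ∧
  ∀ i < I.n, ∀ j < I.n, ∀ k < J.n, ∀ p < J.n,
    pr i j ∈ I.EX ∧ pr i k ∈ F ∧ pr j p ∈ F → pr k p ∈ J.EX

def Cov : Prop :=
  ∃ F, M.len F ≤ dblPr I.n J.n ∧ I.Hom J F ∧
    (∀ i < I.n, ∀ k < J.n, pr i k ∈ F → ∀ a < (l : M.Num), I.Dom i a ↔ J.Dom k a) ∧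
    (∀ i < I.n, ∀ j < I.n, ∀ k < J.n, ∀ p < J.n,
      pr i j ∈ I.EX ∧ pr i k ∈ F ∧ pr j p ∈ F → ∀ a < (l : M.Num), ∀ b < (l : M.Num),
        I.Dom i a ∧ I.Dom j b → (I.Rel i j a b ↔ J.Rel k p a b)) ∧
    ∀ i < I.n, ∀ k < J.n, i = k → pr i k ∈ F

/-- `G` is the image of `H` under a unary vector function that preserves the solutions. -/
def InImages (H G : M.Str) : Prop :=
  ∃ Ψ, M.len Ψ ≤ I.vecBound l ∧ I.UnPol l Ψ ∧ I.Image l Ψ H G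

end SInst

section

variable [W11 M] (l : ℕ) (Θ Λ : Inst) [Θ.Below d] [Λ.Below d]
  (x y z w : NTerm) [x.Below d] [y.Below d] [z.Below d] [w.Below d]
  (G H F Ψ : SVar) [VBelow H d] [VBelow G d] [VBelow F d] [VBelow Ψ d] (C : CVar)

@[simp] theorem val_bd : (Θ.bd l).val M e = (Θ.val e).bound l := by
  simp [Inst.bd, SInst.bound]

@[simp] theorem val_bdVec : (Θ.bdVec l).val M e = (Θ.val e).vecBound l := by
  simp [Inst.bdVec, SInst.vecBound]

@[simp] theorem holds_dom :
    (Θ.dom x y d).Holds M e ↔ (Θ.val e).Dom (x.val M e) (y.val M e) := by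
  simp [Inst.dom, SInst.Dom]

@[simp] theorem holds_rel : (Θ.rel x y z w d).Holds M e ↔
    (Θ.val e).Rel (x.val M e) (y.val M e) (z.val M e) (w.val M e) := by
  simp only [Inst.rel, SInst.Rel, holds_exLt, holds_andB, holds_isPair, holds_mem2, val_var_setN,
    val_setN, val_len, str_setN, Inst.val_EA]
  constructor
  · rintro ⟨_, _, _, _, rfl, rfl, h⟩
    exact h
  · intro h
    exact ⟨_, (left_le_pr _ _).trans_lt (lt_len h), _, (right_le_pr _ _).trans_lt (lt_len h),
      rfl, rfl, h⟩

theorem forall_lt_len {X : M.Str} {P : M.Num → Prop} :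
    (∀ a < M.len X, a ∈ X → P a) ↔ ∀ a ∈ X, P a :=
  ⟨fun h a ha => h a (lt_len ha) ha, fun h a _ ha => h a ha⟩

@[simp] theorem holds_DG : (Θ.DG l d).Holds M e ↔ (Θ.val e).Digraphs l := by
  simp only [Inst.DG, holds_exLt, holds_allLt, holds_andB, holds_isPair, val_var_setN,
    val_setN, val_len, str_setN, holds_impB, holds_inS, holds_eqB, forall_lt_len, val_numeral]
  constructor
  · rintro ⟨h1, h2, h3, h4, h5⟩
    refine ⟨h1, h2, h3, h4, fun z hz => ?_⟩
    obtain ⟨i, hi, j, hj, a, ha, b, hb, s, -, t, -, rfl, rfl, h, hs, ht⟩ := h5 z hz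
    exact ⟨i, hi, j, hj, a, ha, b, hb, h, hs, ht⟩
  · rintro ⟨h1, h2, h3, h4, h5⟩
    refine ⟨h1, h2, h3, h4, fun z hz => ?_⟩
    obtain ⟨i, hi, j, hj, a, ha, b, hb, h, hs, ht⟩ := h5 z hz
    exact ⟨i, hi, j, hj, a, ha, b, hb, _, lt_len hs, _, lt_len ht, rfl, rfl, h, hs, ht⟩

@[simp] theorem holds_isInst {l m : ℕ} (Ω : (Fin m → Fin l) → Fin l) :
    (Θ.isInst Ω d).Holds M e ↔ (Θ.val e).IsInst Ω := by
  simp only [Inst.isInst, holds_andB, holds_DG, holds_allLt, holds_exLt, holds_bigOr,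
    List.mem_map, exists_exists_and_eq_and, holds_iffB, holds_inSet, holds_inRel, holds_dom,
    holds_rel, val_var_setN, val_setN, val_numeral, Inst.val_setN]
  exact ⟨fun ⟨h1, h2, h3, h4⟩ => ⟨h1, h2, h3, h4⟩, fun ⟨h1, h2, h3, h4⟩ => ⟨h1, h2, h3, h4⟩⟩

@[simp] theorem holds_inProd :
    (Θ.inProd l H d).Holds M e ↔ (Θ.val e).InProd l (e.str H) := by
  simp [Inst.inProd, SInst.InProd]

@[simp] theorem holds_sol : (Θ.sol l H d).Holds M e ↔ (Θ.val e).Sol l (e.str H) := by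
  simp [Inst.sol, SInst.Sol]

@[simp] theorem holds_proj :
    (Θ.proj l x G d).Holds M e ↔ (Θ.val e).Proj l (x.val M e) (e.str G) := by
  simp [Inst.proj, SInst.Proj, Maps, forall_lt_len]

@[simp] theorem holds_vecFun :
    (Θ.vecFun l Ψ d).Holds M e ↔ (Θ.val e).VecFun l (e.str Ψ) := by
  simp only [Inst.vecFun, SInst.VecFun, holds_andB, holds_allLt, holds_exLt, holds_impB, holds_inS,
    holds_dom, holds_mem3, holds_eqB, holds_exNum, holds_leB, holds_isPair, val_var_setN,
    val_setN, val_numeral, Inst.val_setN, val_len, str_setN, forall_lt_len, Inst.val_n]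
  refine and_congr_left' (forall₂_congr fun z _ => ?_)
  constructor
  · rintro ⟨i, hi, a, ha, b, hb, s, -, rfl, h⟩
    exact ⟨i, hi, a, ha, b, hb, h⟩
  · rintro ⟨i, hi, a, ha, b, hb, h⟩
    exact ⟨i, hi, a, ha, b, hb, _, h.1 ▸ left_le_pr _ _, rfl, h⟩

@[simp] theorem holds_image :
    (Θ.image l Ψ H G d).Holds M e ↔ (Θ.val e).Image l (e.str Ψ) (e.str H) (e.str G) := by
  simp [Inst.image, SInst.Image, Maps, forall_lt_len]

@[simp] theorem holds_unPol :
    (Θ.unPol l Ψ d).Holds M e ↔ (Θ.val e).UnPol l (e.str Ψ) := by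
  simp [Inst.unPol, SInst.UnPol]

@[simp] theorem holds_hom :
    (Θ.hom Λ F d).Holds M e ↔ (Θ.val e).Hom (Λ.val e) (e.str F) := by
  simp [Inst.hom, SInst.Hom]

@[simp] theorem holds_cov : (Θ.cov l Λ d).Holds M e ↔ (Θ.val e).Cov (Λ.val e) l := by
  simp [Inst.cov, SInst.Cov]

@[simp] theorem holds_isImages : (Λ.isImages l H C d).Holds M e ↔
    ∀ G, M.len G ≤ (Λ.val e).bound l →
      (G ∈ e.cls C ↔ (Λ.val e).InImages l (e.str H) G) := by
  simp [Inst.isImages, SInst.InImages]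

@[simp] theorem holds_defines : (Θ.defines l Λ C d).Holds M e ↔
    (Λ.val e).n ≤ (Θ.val e).n ∧ ∀ G, M.len G ≤ (Λ.val e).bound l →
      (G ∈ e.cls C ↔ (Θ.val e).Proj l (Λ.val e).n G) := by
  simp [Inst.defines]

end

theorem holds_coveringFml [W11 M] {l m : ℕ} (Ω : (Fin m → Fin l) → Fin l) :
    (coveringFml Ω).Holds M e ↔ ∀ (I : SInst M) (H : M.Str), I.IsInst Ω ∧ I.InProd l H →
      ∃ C : M.Cls, (∀ G, M.len G ≤ I.bound l → (G ∈ C ↔ I.InImages l H G)) ∧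
        ∃ J : SInst M, J.IsInst Ω ∧ J.Cov I l ∧ I.n ≤ J.n ∧
          ∀ G, M.len G ≤ I.bound l → (G ∈ C ↔ J.Proj l I.n G) := by
  have h1 : ∀ p : SInst M → Prop, (∃ J, p J) ↔ ∃ n VX EX VA EA, p ⟨n, VX, EX, VA, EA⟩ :=
    fun p => ⟨fun ⟨⟨a, b, c, d, e⟩, h⟩ => ⟨a, b, c, d, e, h⟩,
      fun ⟨a, b, c, d, e, h⟩ => ⟨⟨a, b, c, d, e⟩, h⟩⟩
  have h2 : ∀ p : SInst M → Prop, (∀ J, p J) ↔ ∀ n VX EX VA EA, p ⟨n, VX, EX, VA, EA⟩ :=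
    fun p => ⟨fun h _ _ _ _ _ => h _, fun h ⟨_, _, _, _, _⟩ => h _ _ _ _ _⟩
  simp only [h1, h2]
  simp [coveringFml]
  simp [Inst.val]

end BA

namespace BA

/-! ### Bounded formulas -/

section sigma0

variable (d l : ℕ) (s t x y z w : NTerm) (X V W H G F Ψ : SVar) (C : CVar) (φ ψ : Bld)
  (f : NTerm → Bld) (g : ℕ → Bld)

@[simp] theorem sigma0_eqB : IsSigma0 (eqB s t d) := .eqN _ _
@[simp] theorem sigma0_inS : IsSigma0 (inS t X d) := .memS _ _

@[simp] theorem sigma0_notB : IsSigma0 (notB φ d) ↔ IsSigma0 (φ d) :=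
  ⟨fun h => by cases h; assumption, .neg⟩

@[simp] theorem sigma0_andB : IsSigma0 ((φ ⩓ ψ) d) ↔ IsSigma0 (φ d) ∧ IsSigma0 (ψ d) :=
  ⟨fun h => by cases h; exact ⟨‹_›, ‹_›⟩, fun h => .and h.1 h.2⟩

@[simp] theorem sigma0_orB : IsSigma0 ((φ ⩔ ψ) d) ↔ IsSigma0 (φ d) ∧ IsSigma0 (ψ d) :=
  ⟨fun h => by cases h; exact ⟨‹_›, ‹_›⟩, fun h => .or h.1 h.2⟩

@[simp] theorem sigma0_impB : IsSigma0 ((φ ⇒ᶠ ψ) d) ↔ IsSigma0 (φ d) ∧ IsSigma0 (ψ d) := by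
  simp [impB]

@[simp] theorem sigma0_iffB : IsSigma0 ((φ ⇔ᶠ ψ) d) ↔ IsSigma0 (φ d) ∧ IsSigma0 (ψ d) := by
  simp [iffB, and_comm]

theorem not_occN [h : t.Below d] : ¬ t.OccN d := fun h' => (h.num _ h').false
theorem not_occS [h : t.Below d] : ¬ t.OccS d := fun h' => (h.str _ h').false

@[simp] theorem sigma0_exLt [t.Below d] :
    IsSigma0 (exLt t f d) ↔ IsSigma0 (f (.var d) (d + 1)) := by
  constructor
  · intro h
    cases h with
    | exN _ h => exact ((sigma0_andB (d + 1) _ (f (.var d))).1 h).2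
  · exact fun h => .exN (not_occN d t) (.and (.neg (.eqN _ _)) h)

@[simp] theorem sigma0_allLt [t.Below d] :
    IsSigma0 (allLt t f d) ↔ IsSigma0 (f (.var d) (d + 1)) := by
  constructor
  · intro h
    cases h with
    | allN _ h => exact ((sigma0_impB (d + 1) _ (f (.var d))).1 h).2
  · exact fun h => .allN (not_occN d t) (.or (.neg (.neg (.eqN _ _))) h)

@[simp] theorem sigma0_exStrLe [t.Below d] :
    IsSigma0 (exStrLe t g d) ↔ IsSigma0 (g d (d + 1)) := by
  constructor
  · intro h
    cases h with
    | exS _ h => exact h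
  · exact fun h => .exS (not_occS d t) h

@[simp] theorem sigma0_allStrLe [t.Below d] :
    IsSigma0 (allStrLe t g d) ↔ IsSigma0 (g d (d + 1)) := by
  constructor
  · intro h
    cases h with
    | allS _ h => exact h
  · exact fun h => .allS (not_occS d t) h

@[simp] theorem sigma0_isPair : IsSigma0 (isPair z x y d) := .eqN _ _

variable [VBelow X d] [VBelow V d] [VBelow W d]
  [VBelow H d] [VBelow G d] [VBelow F d] [VBelow Ψ d] (Θ : Inst) [Θ.Below d]

@[simp] theorem sigma0_mem2 : IsSigma0 (mem2 X x y d) := by simp [mem2]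

@[simp] theorem sigma0_mem3 : IsSigma0 (mem3 X x y z d) := by simp [mem3]

@[simp] theorem sigma0_mapsTo : IsSigma0 (mapsTo X x y d) := by simp [mapsTo]

@[simp] theorem sigma0_isPairPt [z.Below d] : IsSigma0 (isPairPt z x y d) :=
  .exN (not_occN d z) (.and (sigma0_isPair ..) (sigma0_isPair ..))

@[simp] theorem sigma0_map : IsSigma0 (map V W H d) := by simp [map]

@[simp] theorem sigma0_dom : IsSigma0 (Θ.dom x y d) := by simp [Inst.dom]

@[simp] theorem sigma0_rel : IsSigma0 (Θ.rel s t x y d) := by simp [Inst.rel]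

@[simp] theorem sigma0_inProd : IsSigma0 (Θ.inProd l H d) := by simp [Inst.inProd]

@[simp] theorem sigma0_sol : IsSigma0 (Θ.sol l H d) := by simp [Inst.sol]

@[simp] theorem sigma0_vecFun : IsSigma0 (Θ.vecFun l Ψ d) := by
  simp only [Inst.vecFun, sigma0_andB, sigma0_allLt, sigma0_impB, sigma0_inS, sigma0_exLt,
    sigma0_dom, sigma0_mem3, sigma0_eqB, true_and, and_true]
  exact .exN (not_occN _ _) (by simp)

@[simp] theorem sigma0_image : IsSigma0 (Θ.image l Ψ H G d) := by simp [Inst.image]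

@[simp] theorem sigma0_unPol : IsSigma0 (Θ.unPol l Ψ d) := by simp [Inst.unPol]

end sigma0

/-! ### Comprehension -/

variable {M : Model3.{u}}

/-- The instance with the names `0` and `0, 1, 2, 3`. -/
def baseInst : Inst := ⟨.var 0, 0, 1, 2, 3⟩

/-- An assignment giving the value `I` to `baseInst`. -/
noncomputable def envI (I : SInst M) (xs : List M.Num) (Xs : List M.Str) : Env M :=
  envOf M (I.n :: xs) (I.VX :: I.EX :: I.VA :: I.EA :: Xs)

@[simp] theorem baseInst_val (I : SInst M) (xs : List M.Num) (Xs : List M.Str) :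
    baseInst.val (envI I xs Xs) = I := rfl

instance : baseInst.Below 10 := by unfold baseInst; infer_instance

variable (I : SInst M) (xs : List M.Num) (Xs : List M.Str)

@[simp] theorem envI_num0 : (NTerm.var 0).val M (envI I xs Xs) = I.n := rfl
@[simp] theorem envI_num1 (k : M.Num) : (NTerm.var 1).val M (envI I (k :: xs) Xs) = k := rfl
@[simp] theorem envI_str1 : (envI I xs Xs).str 1 = I.EX := rfl
@[simp] theorem envI_str4 (A : M.Str) : (envI I xs (A :: Xs)).str 4 = A := rfl
@[simp] theorem envI_str5 (A B : M.Str) : (envI I xs (A :: B :: Xs)).str 5 = B := rfl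
@[simp] theorem envI_str6 (A B C : M.Str) : (envI I xs (A :: B :: C :: Xs)).str 6 = C := rfl

variable [W11 M]

theorem exists_str (f : NTerm → Bld) (d : ℕ) (e : Env M) (hf : IsSigma0 (f (.var d) (d + 1)))
    (b : M.Num) : ∃ Y : M.Str, M.len Y ≤ b ∧
      ∀ a, a ∈ Y ↔ a < b ∧ (f (.var d) (d + 1)).Holds M (e.setN d a) := by
  obtain ⟨Y, hY, h⟩ := W11.out.comp2 _ hf d e b
  refine ⟨Y, hY, fun a => ⟨fun ha => ?_, fun ha => ?_⟩⟩
  · have hab : a < b := (lt_len ha).trans_le hY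
    exact ⟨hab, (h a ((lt_def _ _).2 hab)).2 ha⟩
  · exact (h a ((lt_def _ _).2 ha.1)).1 ha.2

theorem exists_cls (f : SVar → Bld) (d : ℕ) (e : Env M) (hf : IsSigma0 (f d (d + 1)))
    (b : M.Num) : ∃ Y : M.Cls, ∀ A, M.len A ≤ b →
      (A ∈ Y ↔ (f d (d + 1)).Holds M (e.setS d A)) := by
  obtain ⟨Y, h⟩ := W11.out.comp3 _ hf d e b
  exact ⟨Y, fun A hA => (h A hA).symm⟩

/-- Comprehension for sets of pairs. -/
theorem exists_pairs (f : NTerm → NTerm → Bld) (d : ℕ) (e : Env M)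
    (hf : IsSigma0 (f (.var (d + 3)) (.var (d + 4)) (d + 5))) (p q : M.Num) :
    ∃ Y : M.Str, M.len Y ≤ dblPr p q ∧ ∀ z, z ∈ Y ↔ ∃ x < p, ∃ y < q, z = pr x y ∧
      (f (.var (d + 3)) (.var (d + 4)) (d + 5)).Holds M
        (((((e.setN d p).setN (d + 1) q).setN (d + 2) z).setN (d + 3) x).setN (d + 4) y) := by
  obtain ⟨Y, hY, h⟩ := exists_str
    (fun z => exLt (.var d) fun x => exLt (.var (d + 1)) fun y => isPair z x y ⩓ f x y)
    (d + 2) ((e.setN d p).setN (d + 1) q) (by simpa using hf) (dblPr p q)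
  refine ⟨Y, hY, fun z => ?_⟩
  rw [h]
  simp only [holds_exLt, holds_andB, holds_isPair, val_setN, val_var_setN]
  constructor
  · exact fun h => h.2
  · rintro ⟨x, hx, y, hy, rfl, h⟩
    exact ⟨pr_lt_dblPr hx hy.le, x, hx, y, hy, rfl, h⟩

namespace SInst

theorem exists_images_class (l : ℕ) (H : M.Str) : ∃ C : M.Cls, ∀ G, M.len G ≤ I.bound l →
    (G ∈ C ↔ I.InImages l H G) := by
  obtain ⟨C, hC⟩ := exists_cls
    (fun G => exStrLe (baseInst.bdVec l) fun Ψ =>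
      baseInst.unPol l Ψ ⩓ baseInst.image l Ψ 4 G) 10 (envI I [] [H]) (by simp) (I.bound l)
  refine ⟨C, fun G hG => (hC G hG).trans ?_⟩
  simp [InImages]

theorem exists_interval (k : M.Num) : ∃ Y : M.Str, M.len Y ≤ k ∧ ∀ a, a ∈ Y ↔ a < k := by
  obtain ⟨Y, hY, h⟩ := exists_str (fun z => eqB z z) 0 (envOf M [] []) (by simp) k
  exact ⟨Y, hY, fun a => by simp [h]⟩

end SInst

end BA

namespace BA

variable {M : Model3.{u}} [W11 M] {I : SInst M} {l : ℕ}

namespace SInst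

/-! ### Solutions and vector functions -/

theorem Digraphs.dom_lt (h : I.Digraphs l) {i a : M.Num} (hd : I.Dom i a) :
    i < I.n ∧ a < (l : M.Num) := by
  obtain ⟨i', hi, a', ha, he⟩ := h.mem_VA _ hd
  obtain ⟨rfl, rfl⟩ := pr_inj.1 he
  exact ⟨hi, ha⟩

theorem Digraphs.edge_lt (h : I.Digraphs l) {i j : M.Num} (hd : pr i j ∈ I.EX) :
    i < I.n ∧ j < I.n := by
  obtain ⟨i', hi, a', ha, he⟩ := h.mem_EX _ hd
  obtain ⟨rfl, rfl⟩ := pr_inj.1 he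
  exact ⟨hi, ha⟩

theorem Digraphs.mem_VX_iff (h : I.Digraphs l) {i : M.Num} : i ∈ I.VX ↔ i < I.n :=
  ⟨fun hi => h.len_VX ▸ lt_len hi, h.mem_VX i⟩

theorem Digraphs.rel_dom (h : I.Digraphs l) {i j a b : M.Num} (hr : I.Rel i j a b) :
    I.Dom i a ∧ I.Dom j b := by
  obtain ⟨i', -, j', -, a', -, b', -, he, hd⟩ := h.mem_EA _ hr
  obtain ⟨h1, h2⟩ := pr_inj.1 he
  obtain ⟨rfl, rfl⟩ := pr_inj.1 h1
  obtain ⟨rfl, rfl⟩ := pr_inj.1 h2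
  exact hd

theorem Digraphs.inProd_iff (h : I.Digraphs l) {H : M.Str} :
    I.InProd l H ↔ (∀ z ∈ H, ∃ i a, I.Dom i a ∧ z = pr i (pr i a)) ∧
      ∀ i < I.n, ∃ a, Maps H i a ∧ ∀ b, Maps H i b → b = a := by
  constructor
  · rintro ⟨⟨h1, h2⟩, h3⟩
    constructor
    · intro z hz
      obtain ⟨i, hi, s, hs, rfl⟩ := h1 z hz
      obtain ⟨a, -, rfl, ha⟩ := h3 i (h.mem_VX_iff.1 hi) s (lt_len hs) hz
      exact ⟨i, a, ha, rfl⟩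
    · intro i hi
      obtain ⟨s, hs, hz, hu⟩ := h2 i (h.mem_VX i hi)
      obtain ⟨a, -, rfl, ha⟩ := h3 i hi s (lt_len hs) hz
      exact ⟨a, hz, fun b hb => (pr_inj.1 (hu _ hb)).2⟩
  · rintro ⟨h1, h2⟩
    have h1' : ∀ i s, pr i s ∈ H → ∃ a, s = pr i a ∧ I.Dom i a := fun i s hs => by
      obtain ⟨i', a, ha, he⟩ := h1 _ hs
      obtain ⟨rfl, rfl⟩ := pr_inj.1 he
      exact ⟨a, rfl, ha⟩
    refine ⟨⟨fun z hz => ?_, fun i hi => ?_⟩, fun i _ s _ hs => ?_⟩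
    · obtain ⟨i, a, ha, rfl⟩ := h1 z hz
      exact ⟨i, h.mem_VX i (h.dom_lt ha).1, _, ha, rfl⟩
    · obtain ⟨a, ha, hu⟩ := h2 i (h.mem_VX_iff.1 hi)
      obtain ⟨a', he, hd⟩ := h1' _ _ ha
      refine ⟨pr i a, he ▸ hd, ha, fun s hs => ?_⟩
      obtain ⟨b, rfl, -⟩ := h1' _ _ hs
      rw [hu b hs]
    · obtain ⟨a, he, hd⟩ := h1' _ _ hs
      exact ⟨a, (h.dom_lt hd).2, he, hd⟩

theorem Digraphs.dom_of_maps (h : I.Digraphs l) {H : M.Str} (hH : I.InProd l H) {i a : M.Num}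
    (ha : Maps H i a) : I.Dom i a := by
  obtain ⟨i', a', hd, he⟩ := (h.inProd_iff.1 hH).1 _ ha
  obtain ⟨rfl, he⟩ := pr_inj.1 he
  obtain ⟨-, rfl⟩ := pr_inj.1 he
  exact hd

theorem Digraphs.maps_unique (h : I.Digraphs l) {H : M.Str} (hH : I.InProd l H) {i a b : M.Num}
    (ha : Maps H i a) (hb : Maps H i b) : a = b := by
  obtain ⟨c, -, hc⟩ := (h.inProd_iff.1 hH).2 i (h.dom_lt (h.dom_of_maps hH ha)).1
  rw [hc a ha, hc b hb]

theorem Digraphs.sol_iff (h : I.Digraphs l) {H : M.Str} :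
    I.Sol l H ↔ I.InProd l H ∧
      ∀ i j a b, pr i j ∈ I.EX → Maps H i a → Maps H j b → I.Rel i j a b := by
  refine and_congr_right fun hH => ⟨fun hs i j a b he ha hb => ?_, fun hs i hi j hj s hs' t ht => ?_⟩
  · exact hs i (h.edge_lt he).1 j (h.edge_lt he).2 _ (lt_len (h.dom_of_maps hH ha)) _
      (lt_len (h.dom_of_maps hH hb)) ⟨he, ha, hb⟩
  · rintro ⟨he, ha, hb⟩
    obtain ⟨a, -, rfl, -⟩ := hH.2 i hi s hs' ha
    obtain ⟨b, -, rfl, -⟩ := hH.2 j hj t ht hb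
    exact hs i j a b he ha hb

theorem Digraphs.vecFun_iff (h : I.Digraphs l) {Ψ : M.Str} :
    I.VecFun l Ψ ↔ (∀ z ∈ Ψ, ∃ i a b, z = pr (pr i a) b ∧ I.Dom i a ∧ I.Dom i b) ∧
      ∀ i a, I.Dom i a → ∃ b, pr (pr i a) b ∈ Ψ ∧ ∀ c, pr (pr i a) c ∈ Ψ → c = b := by
  have key (h1 : ∀ z ∈ Ψ, ∃ i a b, z = pr (pr i a) b ∧ I.Dom i a ∧ I.Dom i b) (i a b : M.Num)
      (hb : pr (pr i a) b ∈ Ψ) : I.Dom i b := by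
    obtain ⟨i', a', b', he, -, hd⟩ := h1 _ hb
    simp only [pr_inj] at he
    obtain ⟨⟨rfl, rfl⟩, rfl⟩ := he
    exact hd
  constructor
  · rintro ⟨h1, h2⟩
    have h1' : ∀ z ∈ Ψ, ∃ i a b, z = pr (pr i a) b ∧ I.Dom i a ∧ I.Dom i b := fun z hz =>
      let ⟨i, _, a, _, b, _, h⟩ := h1 z hz
      ⟨i, a, b, h⟩
    refine ⟨h1', fun i a hd => ?_⟩
    obtain ⟨b, -, -, hb, hu⟩ := h2 i (h.dom_lt hd).1 a (h.dom_lt hd).2 hd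
    exact ⟨b, hb, fun c hc => hu c (h.dom_lt (key h1' _ _ _ hc)).2 hc⟩
  · rintro ⟨h1, h2⟩
    refine ⟨fun z hz => ?_, fun i _ a _ hd => ?_⟩
    · obtain ⟨i, a, b, he, ha, hb⟩ := h1 z hz
      exact ⟨i, (h.dom_lt ha).1, a, (h.dom_lt ha).2, b, (h.dom_lt hb).2, he, ha, hb⟩
    · obtain ⟨b, hb, hu⟩ := h2 i a hd
      exact ⟨b, (h.dom_lt (key h1 _ _ _ hb)).2, key h1 _ _ _ hb, hb, fun c _ => hu c⟩

theorem Digraphs.dom_of_vecFun (h : I.Digraphs l) {Ψ : M.Str} (hΨ : I.VecFun l Ψ) {i a b : M.Num}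
    (hb : pr (pr i a) b ∈ Ψ) : I.Dom i a ∧ I.Dom i b := by
  obtain ⟨i', a', b', he, hd⟩ := (h.vecFun_iff.1 hΨ).1 _ hb
  simp only [pr_inj] at he
  obtain ⟨⟨rfl, rfl⟩, rfl⟩ := he
  exact hd

theorem Digraphs.image_iff (h : I.Digraphs l) {Ψ H G : M.Str} (hΨ : I.VecFun l Ψ)
    (hH : I.InProd l H) : I.Image l Ψ H G ↔
      (∀ z ∈ G, ∃ i a, I.Dom i a ∧ z = pr i (pr i a)) ∧
      ∀ i a, Maps G i a ↔ ∃ b, Maps H i b ∧ pr (pr i b) a ∈ Ψ := by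
  have key {i a b : M.Num} (hb : pr (pr i a) b ∈ Ψ) : I.Dom i b := (h.dom_of_vecFun hΨ hb).2
  have hmaps {i a : M.Num} (hi : i < I.n) (ha : a < (l : M.Num)) (h2 : Maps G i a ↔
      ∃ b < (l : M.Num), I.Dom i b ∧ Maps H i b ∧ pr (pr i b) a ∈ Ψ) :
      Maps G i a ↔ ∃ b, Maps H i b ∧ pr (pr i b) a ∈ Ψ :=
    h2.trans ⟨fun ⟨b, _, _, h⟩ => ⟨b, h⟩, fun ⟨b, hb, h'⟩ =>
      ⟨b, (h.dom_lt (h.dom_of_maps hH hb)).2, h.dom_of_maps hH hb, hb, h'⟩⟩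
  constructor
  · rintro ⟨h1, h2⟩
    have h2' : ∀ i a, Maps G i a ↔ ∃ b, Maps H i b ∧ pr (pr i b) a ∈ Ψ := by
      intro i a
      by_cases hia : i < I.n ∧ a < (l : M.Num)
      · exact hmaps hia.1 hia.2 (h2 i hia.1 a hia.2)
      · refine iff_of_false (fun hG => hia ?_) fun ⟨b, _, hb⟩ => hia (h.dom_lt (key hb))
        obtain ⟨i', hi, a', ha, he⟩ := h1 _ hG
        obtain ⟨rfl, he⟩ := pr_inj.1 he
        obtain ⟨-, rfl⟩ := pr_inj.1 he
        exact ⟨hi, ha⟩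
    refine ⟨fun z hz => ?_, h2'⟩
    obtain ⟨i, -, a, -, rfl⟩ := h1 z hz
    obtain ⟨b, -, hb⟩ := (h2' i a).1 hz
    exact ⟨i, a, key hb, rfl⟩
  · rintro ⟨h1, h2⟩
    refine ⟨fun z hz => ?_, fun i _ a _ => (h2 i a).trans ?_⟩
    · obtain ⟨i, a, hd, rfl⟩ := h1 z hz
      exact ⟨i, (h.dom_lt hd).1, a, (h.dom_lt hd).2, rfl⟩
    · exact ⟨fun ⟨b, hb, h'⟩ =>
        ⟨b, (h.dom_lt (h.dom_of_maps hH hb)).2, h.dom_of_maps hH hb, hb, h'⟩,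
        fun ⟨b, _, _, h⟩ => ⟨b, h⟩⟩

/-- The image of an element of the product under a unary vector function exists. -/
theorem Digraphs.exists_image (h : I.Digraphs l) {Ψ H : M.Str} (hΨ : I.VecFun l Ψ)
    (hH : I.InProd l H) : ∃ G, M.len G ≤ I.bound l ∧ I.Image l Ψ H G := by
  obtain ⟨G, hG, hG'⟩ := exists_pairs (fun i s => exLt (numeral l) fun a =>
    isPair s i a ⩓ exLt (numeral l) fun b => mapsTo 4 i b ⩓ mem3 5 i b a) 10 (envI I [] [H, Ψ])
    (by simp) I.n (dblPr I.n l)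
  refine ⟨G, hG, (h.image_iff hΨ hH).2 ?_⟩
  simp only [holds_exLt, holds_andB, holds_isPair, holds_mapsTo, holds_mem3, val_var_setN, val_setN,
    val_numeral, str_setN, envI_str4, envI_str5] at hG'
  have hm : ∀ i a, Maps G i a ↔ ∃ b, Maps H i b ∧ pr (pr i b) a ∈ Ψ := by
    intro i a
    rw [Maps, hG']
    constructor
    · rintro ⟨_, -, _, -, he, a', -, rfl, b, -, h1, h2⟩
      simp only [pr_inj] at he
      obtain ⟨rfl, -, rfl⟩ := he
      exact ⟨b, h1, h2⟩
    · rintro ⟨b, hb, hΨb⟩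
      have hd := h.dom_of_vecFun hΨ hΨb
      have hi := (h.dom_lt hd.1).1
      have ha := (h.dom_lt hd.2).2
      exact ⟨i, hi, _, pr_lt_dblPr hi ha.le, rfl, a, ha, rfl, b, (h.dom_lt hd.1).2, hb, hΨb⟩
  refine ⟨fun z hz => ?_, hm⟩
  obtain ⟨i, -, _, -, rfl, a, -, rfl, -⟩ := (hG' z).1 hz
  obtain ⟨b, -, hb⟩ := (hm i a).1 hz
  exact ⟨i, a, (h.dom_of_vecFun hΨ hb).2, rfl⟩

/-! ### Labelled variables -/

end SInst

/-- `⟨⟨v, i⟩, a⟩ ∈ L`: the variable `v` stands for the value of `ψ_i` at `a`. -/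
def Lab (L : M.Str) (v i a : M.Num) : Prop := pr (pr v i) a ∈ L

namespace SInst

/-- `L` labels the variables below `k` with the pairs `(i, a)`, `a ∈ D_i`, all of which occur;
the label of `i < n` is `(i, H(i))`. -/
structure Labelling (I : SInst M) (l : ℕ) (H : M.Str) (k : M.Num) (L : M.Str) : Prop where
  n_le : I.n ≤ k
  lt : ∀ v i a, Lab L v i a → v < k
  dom : ∀ v i a, Lab L v i a → I.Dom i a
  total : ∀ v < k, ∃ i a, Lab L v i a
  unique : ∀ v i a i' a', Lab L v i a → Lab L v i' a' → i = i' ∧ a = a'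
  self : ∀ i a, Maps H i a → Lab L i i a
  rep : ∀ i a, I.Dom i a → ∃ v, Lab L v i a ∧ (Maps H i a → v = i) ∧
    ∀ w, Lab L w i a → (Maps H i a → w = i) → w = v

theorem exists_add_mul {n v : M.Num} {k : ℕ} (h : v < n * (k : M.Num)) :
    ∃ i < n, ∃ c < (k : M.Num), v = i + n * c := by
  induction k with
  | zero => simp at h
  | succ k ih =>
    rw [Nat.cast_succ] at h ⊢
    by_cases hv : v < n * (k : M.Num)
    · obtain ⟨i, hi, c, hc, he⟩ := ih hv
      exact ⟨i, hi, c, hc.trans (W11.lt_add_one_iff.2 le_rfl), he⟩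
    · obtain ⟨i, rfl⟩ := W11.exists_add (not_lt.1 hv)
      rw [mul_add, mul_one, add_lt_add_iff_left] at h
      exact ⟨i, h, k, W11.lt_add_one_iff.2 le_rfl, add_comm _ _⟩

theorem add_mul_lt {n i c c' : M.Num} (hi : i < n) (h : c < c') : i + n * c < n * c' :=
  calc i + n * c < n + n * c := by gcongr
    _ = n * (c + 1) := by ring
    _ ≤ n * c' := by gcongr; exact W11.add_one_le_iff.2 h

theorem add_mul_inj {n i i' c c' : M.Num} (hi : i < n) (hi' : i' < n)
    (h : i + n * c = i' + n * c') : i = i' ∧ c = c' := by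
  have hc : c = c' := by
    rcases lt_trichotomy c c' with hl | he | hl
    · exact absurd h ((add_mul_lt hi hl).trans_le le_add_self).ne
    · exact he
    · exact absurd h ((add_mul_lt hi' hl).trans_le le_add_self).ne'
  subst hc
  exact ⟨add_right_cancel h, rfl⟩

theorem Digraphs.exists_labelling (h : I.Digraphs l) {H : M.Str} (hH : I.InProd l H) :
    ∃ k L, I.Labelling l H k L := by
  set k := I.n * ((l : M.Num) + 1) with hk
  obtain ⟨L, -, hL⟩ := exists_pairs (fun x a => exLt (.var 1) fun v => exLt (.var 0) fun i =>
    isPair x v i ⩓ exLt (numeral (l + 1)) fun c => eqB v (.add i (.mul (.var 0) c)) ⩓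
      (baseInst.dom i a ⩓ eqB c (.add a .one) ⩔ mapsTo 4 i a ⩓
        allLt (numeral l) fun b => baseInst.dom i b ⇒ᶠ notB (eqB c (.add b .one))))
    10 (envI I [k] [H]) (by simp) (dblPr k I.n) l
  simp only [holds_exLt, holds_andB, holds_isPair, holds_mapsTo, holds_dom, holds_eqB, holds_orB,
    holds_allLt, holds_impB, holds_notB, val_var_setN, val_setN, val_numeral, val_add, val_mul,
    val_one, str_setN, Inst.val_setN, baseInst_val, envI_num0, envI_num1, envI_str4,
    Nat.cast_succ] at hL
  have hL' : ∀ v i a, Lab L v i a ↔ ∃ c < (l : M.Num) + 1, v = i + I.n * c ∧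
      (I.Dom i a ∧ c = a + 1 ∨ Maps H i a ∧ ∀ b, I.Dom i b → c ≠ b + 1) := by
    intro v i a
    rw [Lab, hL]
    constructor
    · rintro ⟨_, -, a', -, he, v', -, i', -, rfl, c, hc, hv, h1⟩
      simp only [pr_inj] at he
      obtain ⟨⟨rfl, rfl⟩, rfl⟩ := he
      exact ⟨c, hc, hv, h1.imp_right fun h1 => ⟨h1.1, fun b hb => h1.2 b (h.dom_lt hb).2 hb⟩⟩
    · rintro ⟨c, hc, rfl, h1⟩
      have hd : I.Dom i a := h1.elim And.left fun h1 => h.dom_of_maps hH h1.1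
      have hi := (h.dom_lt hd).1
      have hv : i + I.n * c < k := add_mul_lt hi hc
      exact ⟨_, pr_lt_dblPr hv hi.le, a, (h.dom_lt hd).2, rfl, _, hv, i, hi, rfl, c, hc, rfl,
        h1.imp_right fun h1 => ⟨h1.1, fun b _ => h1.2 b⟩⟩
  have hdom : ∀ v i a, Lab L v i a → I.Dom i a := by
    intro v i a hv
    obtain ⟨c, -, -, h1⟩ := (hL' v i a).1 hv
    exact h1.elim And.left fun h1 => h.dom_of_maps hH h1.1
  have hself : ∀ i a, Maps H i a → Lab L i i a := fun i a ha =>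
    (hL' i i a).2 ⟨0, W11.lt_add_one_iff.2 zero_le, by simp, .inr ⟨ha, fun b _ =>
      (W11.lt_add_one_iff.2 zero_le).ne⟩⟩
  refine ⟨k, L, ?_, ?_, hdom, ?_, ?_, hself, ?_⟩
  · rw [hk, mul_add, mul_one]
    exact le_add_self
  · intro v i a hv
    have hi := (h.dom_lt (hdom v i a hv)).1
    obtain ⟨c, hc, rfl, -⟩ := (hL' v i a).1 hv
    exact add_mul_lt hi hc
  · intro v hv
    rw [hk, ← Nat.cast_succ] at hv
    obtain ⟨i, hi, c, hc, rfl⟩ := exists_add_mul hv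
    rw [Nat.cast_succ] at hc
    by_cases hb : ∃ b, I.Dom i b ∧ c = b + 1
    · obtain ⟨b, hb, hcb⟩ := hb
      exact ⟨i, b, (hL' _ _ _).2 ⟨c, hc, rfl, .inl ⟨hb, hcb⟩⟩⟩
    · push Not at hb
      obtain ⟨a, ha, -⟩ := (h.inProd_iff.1 hH).2 i hi
      exact ⟨i, a, (hL' _ _ _).2 ⟨c, hc, rfl, .inr ⟨ha, hb⟩⟩⟩
  · intro v i a i' a' hv hv'
    have hi := (h.dom_lt (hdom v i a hv)).1
    have hi' := (h.dom_lt (hdom v i' a' hv')).1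
    obtain ⟨c, -, rfl, h1⟩ := (hL' _ _ _).1 hv
    obtain ⟨c', -, he, h2⟩ := (hL' _ _ _).1 hv'
    obtain ⟨rfl, rfl⟩ := add_mul_inj hi hi' he
    refine ⟨rfl, ?_⟩
    rcases h1 with ⟨hd, h1⟩ | ⟨hm, h1⟩ <;> rcases h2 with ⟨hd', h2⟩ | ⟨hm', h2⟩
    · exact add_right_cancel (h1.symm.trans h2)
    · exact absurd h1 (h2 a hd)
    · exact absurd h2 (h1 a' hd')
    · exact h.maps_unique hH hm hm'
  · intro i a hd
    by_cases hm : Maps H i a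
    · exact ⟨i, hself i a hm, fun _ => rfl, fun w _ hw => hw hm⟩
    · refine ⟨i + I.n * (a + 1), (hL' _ _ _).2 ⟨a + 1, ?_, rfl, .inl ⟨hd, rfl⟩⟩,
        fun h => absurd h hm, fun w hw _ => ?_⟩
      · exact add_lt_add_left (h.dom_lt hd).2 1
      · obtain ⟨c, -, rfl, h1⟩ := (hL' _ _ _).1 hw
        obtain ⟨-, rfl⟩ := h1.resolve_right fun h => hm h.1
        rfl

/-! ### The covering -/

/-- The covering whose solutions are the unary vector functions preserving the solutions of `I`,
listed along the labelling `L`. -/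
structure IsCovering (I : SInst M) (l : ℕ) (k : M.Num) (L : M.Str) (J : SInst M) : Prop where
  n_eq : J.n = k
  digraphs : J.Digraphs l
  dom_iff : ∀ v i c, Lab L v i c → ∀ a, J.Dom v a ↔ I.Dom i a
  rel_iff : ∀ v i c w j c', Lab L v i c → Lab L w j c' → ∀ a b, J.Rel v w a b ↔ I.Rel i j a b
  edge_iff : ∀ v w, pr v w ∈ J.EX ↔ ∃ i a j b, Lab L v i a ∧ Lab L w j b ∧ pr i j ∈ I.EX ∧
    ∃ K, M.len K ≤ I.bound l ∧ I.Sol l K ∧ Maps K i a ∧ Maps K j b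

theorem Digraphs.exists_covering (h : I.Digraphs l) {H L : M.Str} {k : M.Num}
    (hL : I.Labelling l H k L) : ∃ J, I.IsCovering l k L J := by
  obtain ⟨VX, hVX, hVX'⟩ := exists_interval k
  obtain ⟨EX, -, hEX⟩ := exists_pairs (fun v w =>
    exLt (.var 0) fun i => exLt (numeral l) fun a => exLt (.var 0) fun j => exLt (numeral l) fun b =>
      mem3 4 v i a ⩓ mem3 4 w j b ⩓ mem2 1 i j ⩓ exStrLe (baseInst.bd l) fun K =>
        baseInst.sol l K ⩓ mapsTo K i a ⩓ mapsTo K j b)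
    10 (envI I [] [L]) (by simp) k k
  obtain ⟨VA, -, hVA⟩ := exists_pairs (fun v a =>
    exLt (.var 0) fun i => exLt (numeral l) fun c => mem3 4 v i c ⩓ baseInst.dom i a)
    10 (envI I [] [L]) (by simp) k l
  obtain ⟨EA, -, hEA⟩ := exists_pairs (fun x y =>
    exLt (.var 1) fun v => exLt (.var 1) fun w => exLt (numeral l) fun a => exLt (numeral l) fun b =>
      isPair x v a ⩓ isPair y w b ⩓
      exLt (.var 0) fun i => exLt (numeral l) fun c => exLt (.var 0) fun j => exLt (numeral l) fun d =>
      mem3 4 v i c ⩓ mem3 4 w j d ⩓ baseInst.rel i j a b)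
    10 (envI I [k] [L]) (by simp) (dblPr k l) (dblPr k l)
  simp only [holds_exLt, holds_andB, holds_isPair, holds_mem2, holds_mem3, holds_dom, holds_rel,
    holds_exStrLe, holds_sol, holds_mapsTo, val_bd, val_var_setN, val_setN, val_setS, val_numeral,
    str_setN, str_setS_self, Inst.val_setN, Inst.val_setS, baseInst_val, envI_num0,
    envI_num1, envI_str1, envI_str4] at hEX hVA hEA
  have hlt {v i a : M.Num} (hv : Lab L v i a) : v < k ∧ i < I.n ∧ a < (l : M.Num) :=
    ⟨hL.lt _ _ _ hv, h.dom_lt (hL.dom _ _ _ hv)⟩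
  have hd : ∀ v a, pr v a ∈ VA ↔ ∃ i c, Lab L v i c ∧ I.Dom i a := by
    intro v a
    rw [hVA]
    constructor
    · rintro ⟨_, -, _, -, he, i, -, c, -, hv, hd⟩
      obtain ⟨rfl, rfl⟩ := pr_inj.1 he
      exact ⟨i, c, hv, hd⟩
    · rintro ⟨i, c, hv, hd⟩
      exact ⟨v, (hlt hv).1, a, (h.dom_lt hd).2, rfl, i, (hlt hv).2.1, c, (hlt hv).2.2, hv, hd⟩
  have hr : ∀ v w a b, pr (pr v a) (pr w b) ∈ EA ↔
      ∃ i c j d, Lab L v i c ∧ Lab L w j d ∧ I.Rel i j a b := by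
    intro v w a b
    rw [hEA]
    constructor
    · rintro ⟨_, -, _, -, he, v', -, w', -, a', -, b', -, rfl, rfl, i, -, c, -, j, -, d, -, h⟩
      simp only [pr_inj] at he
      obtain ⟨⟨rfl, rfl⟩, rfl, rfl⟩ := he
      exact ⟨i, c, j, d, h⟩
    · rintro ⟨i, c, j, d, hv, hw, hr⟩
      have hdom := h.rel_dom hr
      have ha := (h.dom_lt hdom.1).2
      have hb := (h.dom_lt hdom.2).2
      exact ⟨_, pr_lt_dblPr (hlt hv).1 ha.le, _, pr_lt_dblPr (hlt hw).1 hb.le, rfl,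
        v, (hlt hv).1, w, (hlt hw).1, a, ha, b, hb, rfl, rfl, i, (hlt hv).2.1, c, (hlt hv).2.2,
        j, (hlt hw).2.1, d, (hlt hw).2.2, hv, hw, hr⟩
  refine ⟨⟨k, VX, EX, VA, EA⟩, rfl, ⟨len_eq hVX fun a ha => (hVX' a).2 ha,
    fun i hi => (hVX' i).2 hi, fun z hz => ?_, fun z hz => ?_, fun z hz => ?_⟩, ?_, ?_, ?_⟩
  · obtain ⟨v, hv, w, hw, he, -⟩ := (hEX z).1 hz
    exact ⟨v, hv, w, hw, he⟩
  · obtain ⟨v, hv, a, ha, he, -⟩ := (hVA z).1 hz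
    exact ⟨v, hv, a, ha, he⟩
  · obtain ⟨_, -, _, -, rfl, v, hv, w, hw, a, ha, b, hb, rfl, rfl, -⟩ := (hEA z).1 hz
    obtain ⟨i, c, j, d, hv', hw', hr⟩ := (hr v w a b).1 hz
    have hdom := h.rel_dom hr
    exact ⟨v, hv, w, hw, a, ha, b, hb, rfl, (hd _ _).2 ⟨i, c, hv', hdom.1⟩,
      (hd _ _).2 ⟨j, d, hw', hdom.2⟩⟩
  · intro v i c hv a
    refine (hd v a).trans ⟨?_, fun h => ⟨i, c, hv, h⟩⟩
    rintro ⟨i', c', hv', hd⟩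
    rwa [(hL.unique _ _ _ _ _ hv hv').1]
  · intro v i c w j d hv hw a b
    refine (hr v w a b).trans ⟨?_, fun h => ⟨i, c, j, d, hv, hw, h⟩⟩
    rintro ⟨i', c', j', d', hv', hw', hr⟩
    rwa [(hL.unique _ _ _ _ _ hv hv').1, (hL.unique _ _ _ _ _ hw hw').1]
  · intro v w
    refine (hEX _).trans ⟨?_, ?_⟩
    · rintro ⟨_, -, _, -, he, i, -, a, -, j, -, b, -, h⟩
      obtain ⟨rfl, rfl⟩ := pr_inj.1 he
      exact ⟨i, a, j, b, h⟩
    · rintro ⟨i, a, j, b, hv, hw, h⟩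
      exact ⟨v, (hlt hv).1, w, (hlt hw).1, rfl, i, (hlt hv).2.1, a, (hlt hv).2.2,
        j, (hlt hw).2.1, b, (hlt hw).2.2, hv, hw, h⟩

section

variable {H L : M.Str} {k : M.Num} {J : SInst M}

theorem IsCovering.isInst {l m : ℕ} {Ω : (Fin m → Fin l) → Fin l} (h : I.IsInst Ω)
    (hL : I.Labelling l H k L) (hJ : I.IsCovering l k L J) : J.IsInst Ω := by
  refine ⟨hJ.digraphs, fun v hv => ?_, fun v hv => ?_, fun v hv w hw => ?_⟩
  · obtain ⟨i, c, hc⟩ := hL.total v (hJ.n_eq ▸ hv)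
    have hd := hL.dom _ _ _ hc
    exact ⟨c, (h.dom_lt hd).2, (hJ.dom_iff _ _ _ hc c).2 hd⟩
  · obtain ⟨i, c, hc⟩ := hL.total v (hJ.n_eq ▸ hv)
    obtain ⟨B, hB, hB'⟩ := h.dom_mem i (h.dom_lt (hL.dom _ _ _ hc)).1
    exact ⟨B, hB, fun a ha => (hJ.dom_iff _ _ _ hc a).trans (hB' a ha)⟩
  · obtain ⟨i, c, hc⟩ := hL.total v (hJ.n_eq ▸ hv)
    obtain ⟨j, d, hd⟩ := hL.total w (hJ.n_eq ▸ hw)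
    obtain ⟨R, hR, hR'⟩ := h.rel_mem i (h.dom_lt (hL.dom _ _ _ hc)).1 j
      (h.dom_lt (hL.dom _ _ _ hd)).1
    exact ⟨R, hR, fun a ha b hb => (hJ.rel_iff _ _ _ _ _ _ hc hd a b).trans (hR' a ha b hb)⟩

theorem IsCovering.cov (h : I.Digraphs l) (hH : I.InProd l H)
    (hL : I.Labelling l H k L) (hJ : I.IsCovering l k L J) : J.Cov I l := by
  obtain ⟨F, hF, hF'⟩ := exists_pairs (fun v i => exLt (numeral l) fun a => mem3 4 v i a)
    10 (envI I [] [L]) (by simp) k I.n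
  simp only [holds_exLt, holds_mem3, val_var_setN, val_setN, val_numeral, str_setN,
    envI_str4] at hF'
  have hm : ∀ v i, pr v i ∈ F ↔ ∃ a, Lab L v i a := by
    intro v i
    rw [hF']
    constructor
    · rintro ⟨_, -, _, -, he, a, -, ha⟩
      obtain ⟨rfl, rfl⟩ := pr_inj.1 he
      exact ⟨a, ha⟩
    · rintro ⟨a, ha⟩
      have hd := h.dom_lt (hL.dom _ _ _ ha)
      exact ⟨v, hL.lt _ _ _ ha, i, hd.1, rfl, a, hd.2, ha⟩
  refine ⟨F, hJ.n_eq ▸ hF, ⟨⟨fun z hz => ?_, fun v hv => ?_⟩, ?_⟩, ?_, ?_, ?_⟩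
  · obtain ⟨v, hv, i, hi, rfl, -⟩ := (hF' z).1 hz
    exact ⟨v, hJ.digraphs.mem_VX v (hJ.n_eq ▸ hv), i, h.mem_VX i hi, rfl⟩
  · obtain ⟨i, a, ha⟩ := hL.total v (hJ.n_eq ▸ hJ.digraphs.mem_VX_iff.1 hv)
    refine ⟨i, h.mem_VX i (h.dom_lt (hL.dom _ _ _ ha)).1, (hm _ _).2 ⟨a, ha⟩, fun j hj => ?_⟩
    obtain ⟨b, hb⟩ := (hm _ _).1 hj
    exact (hL.unique _ _ _ _ _ hb ha).1
  · rintro v - w - i - j - ⟨he, hv, hw⟩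
    obtain ⟨i', a, j', b, ha, hb, he, -⟩ := (hJ.edge_iff v w).1 he
    obtain ⟨c, hc⟩ := (hm _ _).1 hv
    obtain ⟨d, hd⟩ := (hm _ _).1 hw
    rwa [(hL.unique _ _ _ _ _ hc ha).1, (hL.unique _ _ _ _ _ hd hb).1]
  · intro v _ i _ hv a _
    obtain ⟨c, hc⟩ := (hm _ _).1 hv
    exact hJ.dom_iff _ _ _ hc a
  · rintro v - w - i - j - ⟨-, hv, hw⟩ a - b - -
    obtain ⟨c, hc⟩ := (hm _ _).1 hv
    obtain ⟨d, hd⟩ := (hm _ _).1 hw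
    exact hJ.rel_iff _ _ _ _ _ _ hc hd a b
  · rintro v - i hi rfl
    obtain ⟨a, ha, -⟩ := (h.inProd_iff.1 hH).2 v hi
    exact (hm _ _).2 ⟨a, hL.self _ _ ha⟩

/-- A unary vector function preserving the solutions gives a solution of the covering. -/
theorem IsCovering.exists_sol (h : I.Digraphs l) (hL : I.Labelling l H k L)
    (hJ : I.IsCovering l k L J) {Ψ : M.Str} (hΨ : I.UnPol l Ψ) :
    ∃ K, M.len K ≤ J.bound l ∧ J.Sol l K ∧
      ∀ v b, Maps K v b ↔ ∃ i a, Lab L v i a ∧ pr (pr i a) b ∈ Ψ := by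
  obtain ⟨K, hK, hK'⟩ := exists_pairs (fun v s => exLt (numeral l) fun b => isPair s v b ⩓
    exLt (.var 0) fun i => exLt (numeral l) fun a => mem3 4 v i a ⩓ mem3 5 i a b)
    10 (envI I [] [L, Ψ]) (by simp) k (dblPr k l)
  simp only [holds_exLt, holds_andB, holds_isPair, holds_mem3, val_var_setN, val_setN,
    val_numeral, str_setN, envI_num0, envI_str4, envI_str5] at hK'
  have hm : ∀ v b, Maps K v b ↔ ∃ i a, Lab L v i a ∧ pr (pr i a) b ∈ Ψ := by
    intro v b
    rw [Maps, hK']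
    constructor
    · rintro ⟨_, -, _, -, he, b', -, rfl, i, -, a, -, ha⟩
      simp only [pr_inj] at he
      obtain ⟨rfl, -, rfl⟩ := he
      exact ⟨i, a, ha⟩
    · rintro ⟨i, a, ha, hb⟩
      have hd := h.dom_lt (hL.dom _ _ _ ha)
      have hb' := (h.dom_lt (h.dom_of_vecFun hΨ.1 hb).2).2
      have hv := hL.lt _ _ _ ha
      exact ⟨v, hv, _, pr_lt_dblPr hv hb'.le, rfl, b, hb', rfl, i, hd.1, a, hd.2, ha, hb⟩
  refine ⟨K, by rwa [bound, hJ.n_eq], hJ.digraphs.sol_iff.2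
    ⟨hJ.digraphs.inProd_iff.2 ⟨fun z hz => ?_, fun v hv => ?_⟩, ?_⟩, hm⟩
  · obtain ⟨v, -, _, -, rfl, b, -, rfl, -⟩ := (hK' z).1 hz
    obtain ⟨i, a, ha, hb⟩ := (hm v b).1 hz
    exact ⟨v, b, (hJ.dom_iff _ _ _ ha b).2 (h.dom_of_vecFun hΨ.1 hb).2, rfl⟩
  · obtain ⟨i, a, ha⟩ := hL.total v (hJ.n_eq ▸ hv)
    obtain ⟨b, hb, hu⟩ := (h.vecFun_iff.1 hΨ.1).2 i a (hL.dom _ _ _ ha)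
    refine ⟨b, (hm _ _).2 ⟨i, a, ha, hb⟩, fun c hc => ?_⟩
    obtain ⟨i', a', ha', hc⟩ := (hm _ _).1 hc
    obtain ⟨rfl, rfl⟩ := hL.unique _ _ _ _ _ ha ha'
    exact hu c hc
  · intro v w c d he hc hd
    obtain ⟨i, a, j, b, ha, hb, he, A, hA, hAs, hAi, hAj⟩ := (hJ.edge_iff v w).1 he
    obtain ⟨i', a', ha', hc⟩ := (hm _ _).1 hc
    obtain ⟨rfl, rfl⟩ := hL.unique _ _ _ _ _ ha ha'
    obtain ⟨j', b', hb', hd⟩ := (hm _ _).1 hd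
    obtain ⟨rfl, rfl⟩ := hL.unique _ _ _ _ _ hb hb'
    obtain ⟨G, hG, hGA⟩ := h.exists_image hΨ.1 hAs.1
    have hGs := hΨ.2 A hA G hG ⟨hAs, hGA⟩
    have hGm := ((h.image_iff hΨ.1 hAs.1).1 hGA).2
    exact (hJ.rel_iff _ _ _ _ _ _ ha hb c d).2
      ((h.sol_iff.1 hGs).2 i j c d he ((hGm _ _).2 ⟨a, hAi, hc⟩) ((hGm _ _).2 ⟨b, hAj, hd⟩))

theorem IsCovering.proj_of_inImages (h : I.Digraphs l) (hH : I.InProd l H)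
    (hL : I.Labelling l H k L) (hJ : I.IsCovering l k L J) {G : M.Str}
    (hG : I.InImages l H G) : J.Proj l I.n G := by
  obtain ⟨Ψ, -, hΨ, hIm⟩ := hG
  obtain ⟨hG, hGm⟩ := (h.image_iff hΨ.1 hH).1 hIm
  obtain ⟨K, hK, hKs, hKm⟩ := hJ.exists_sol h hL hΨ
  have hself {i : M.Num} (hi : i < I.n) : ∃ a, Maps H i a ∧ Lab L i i a := by
    obtain ⟨a, ha, -⟩ := (h.inProd_iff.1 hH).2 i hi
    exact ⟨a, ha, hL.self _ _ ha⟩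
  refine ⟨fun z hz => ?_, fun i hi => ?_, K, hK, hKs, fun i hi a _ => ?_⟩
  · obtain ⟨i, a, ha, rfl⟩ := hG z hz
    obtain ⟨b, -, hb⟩ := hself (h.dom_lt ha).1
    exact ⟨i, (h.dom_lt ha).1, a, (h.dom_lt ha).2, (hJ.dom_iff _ _ _ hb a).2 ha, rfl⟩
  · obtain ⟨b, hb, hbL⟩ := hself hi
    obtain ⟨a, ha, hu⟩ := (h.vecFun_iff.1 hΨ.1).2 i b (hL.dom _ _ _ hbL)
    have hd := (h.dom_of_vecFun hΨ.1 ha).2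
    refine ⟨a, (h.dom_lt hd).2, (hJ.dom_iff _ _ _ hbL a).2 hd, (hGm _ _).2 ⟨b, hb, ha⟩,
      fun c _ hc => ?_⟩
    obtain ⟨b', hb', hc⟩ := (hGm _ _).1 hc
    obtain rfl := h.maps_unique hH hb hb'
    exact hu c hc
  · rw [hGm, hKm]
    constructor
    · rintro ⟨b, hb, ha⟩
      exact ⟨i, b, hL.self _ _ hb, ha⟩
    · rintro ⟨i', b', hb', ha⟩
      obtain ⟨b, hb, hbL⟩ := hself hi
      obtain ⟨rfl, rfl⟩ := hL.unique _ _ _ _ _ hbL hb'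
      exact ⟨b, hb, ha⟩

/-- A solution of the covering gives a unary vector function preserving the solutions. -/
theorem IsCovering.exists_unPol (h : I.Digraphs l) (hL : I.Labelling l H k L)
    (hJ : I.IsCovering l k L J) {K : M.Str} (hK : J.Sol l K) :
    ∃ Ψ, M.len Ψ ≤ I.vecBound l ∧ I.UnPol l Ψ ∧ ∀ i a b, pr (pr i a) b ∈ Ψ ↔
      ∃ v, Lab L v i a ∧ (Maps H i a → v = i) ∧ Maps K v b := by
  obtain ⟨Ψ, hΨ, hΨ'⟩ := exists_pairs (fun x b => exLt (.var 0) fun i => exLt (numeral l) fun a =>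
    isPair x i a ⩓ exLt (.var 1) fun v => mem3 5 v i a ⩓ (mapsTo 4 i a ⇒ᶠ eqB v i) ⩓ mapsTo 6 v b)
    10 (envI I [k] [H, L, K]) (by simp) (dblPr I.n l) l
  simp only [holds_exLt, holds_andB, holds_isPair, holds_mem3, holds_mapsTo, holds_impB, holds_eqB,
    val_var_setN, val_setN, val_numeral, str_setN, envI_num0, envI_num1, envI_str4, envI_str5,
    envI_str6] at hΨ'
  have hKd {v i a b : M.Num} (hv : Lab L v i a) (hb : Maps K v b) : I.Dom i b :=
    (hJ.dom_iff _ _ _ hv b).1 (hJ.digraphs.dom_of_maps hK.1 hb)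
  have hm : ∀ i a b, pr (pr i a) b ∈ Ψ ↔
      ∃ v, Lab L v i a ∧ (Maps H i a → v = i) ∧ Maps K v b := by
    intro i a b
    rw [hΨ']
    constructor
    · rintro ⟨_, -, _, -, he, i', -, a', -, rfl, v, -, hv⟩
      simp only [pr_inj] at he
      obtain ⟨⟨rfl, rfl⟩, rfl⟩ := he
      exact ⟨v, hv⟩
    · rintro ⟨v, hv, hv', hb⟩
      have hd := h.dom_lt (hL.dom _ _ _ hv)
      exact ⟨_, pr_lt_dblPr hd.1 hd.2.le, b, (h.dom_lt (hKd hv hb)).2, rfl, i, hd.1, a, hd.2, rfl,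
        v, hL.lt _ _ _ hv, hv, hv', hb⟩
  have hV : I.VecFun l Ψ := by
    refine h.vecFun_iff.2 ⟨fun z hz => ?_, fun i a hd => ?_⟩
    · obtain ⟨_, -, b, -, rfl, i, -, a, -, rfl, -⟩ := (hΨ' z).1 hz
      obtain ⟨v, hv, -, hb⟩ := (hm _ _ _).1 hz
      exact ⟨i, a, b, rfl, hL.dom _ _ _ hv, hKd hv hb⟩
    · obtain ⟨v, hv, hv', hu⟩ := hL.rep i a hd
      obtain ⟨b, hb, hbu⟩ :=
        (hJ.digraphs.inProd_iff.1 hK.1).2 v (hJ.n_eq.symm ▸ hL.lt _ _ _ hv)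
      refine ⟨b, (hm _ _ _).2 ⟨v, hv, hv', hb⟩, fun c hc => ?_⟩
      obtain ⟨w, hw, hw', hc⟩ := (hm _ _ _).1 hc
      obtain rfl := hu w hw hw'
      exact hbu c hc
  refine ⟨Ψ, hΨ, ⟨hV, ?_⟩, hm⟩
  rintro A hA G - ⟨hAs, hIm⟩
  obtain ⟨hG, hGm⟩ := (h.image_iff hV hAs.1).1 hIm
  refine h.sol_iff.2 ⟨h.inProd_iff.2 ⟨hG, fun i hi => ?_⟩, fun i j c d he hc hd => ?_⟩
  · obtain ⟨a, ha, hau⟩ := (h.inProd_iff.1 hAs.1).2 i hi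
    obtain ⟨b, hb, hbu⟩ := (h.vecFun_iff.1 hV).2 i a (h.dom_of_maps hAs.1 ha)
    refine ⟨b, (hGm _ _).2 ⟨a, ha, hb⟩, fun c hc => ?_⟩
    obtain ⟨a', ha', hc⟩ := (hGm _ _).1 hc
    obtain rfl := hau a' ha'
    exact hbu c hc
  · obtain ⟨a, ha, hc⟩ := (hGm _ _).1 hc
    obtain ⟨b, hb, hd⟩ := (hGm _ _).1 hd
    obtain ⟨v, hv, -, hc⟩ := (hm _ _ _).1 hc
    obtain ⟨w, hw, -, hd⟩ := (hm _ _ _).1 hd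
    refine (hJ.rel_iff _ _ _ _ _ _ hv hw c d).1 ((hJ.digraphs.sol_iff.1 hK).2 v w c d ?_ hc hd)
    exact (hJ.edge_iff v w).2 ⟨i, a, j, b, hv, hw, he, A, hA, hAs, ha, hb⟩

theorem IsCovering.inImages_of_proj (h : I.Digraphs l) (hH : I.InProd l H)
    (hL : I.Labelling l H k L) (hJ : I.IsCovering l k L J) {G : M.Str}
    (hG : J.Proj l I.n G) : I.InImages l H G := by
  obtain ⟨hG1, -, K, -, hK, hGK⟩ := hG
  obtain ⟨Ψ, hΨ, hU, hm⟩ := hJ.exists_unPol h hL hK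
  have hG : ∀ z ∈ G, ∃ i a, I.Dom i a ∧ z = pr i (pr i a) := by
    intro z hz
    obtain ⟨i, hi, a, -, hd, rfl⟩ := hG1 z hz
    obtain ⟨b, hb, -⟩ := (h.inProd_iff.1 hH).2 i hi
    exact ⟨i, a, (hJ.dom_iff _ _ _ (hL.self _ _ hb) a).1 hd, rfl⟩
  refine ⟨Ψ, hΨ, hU, (h.image_iff hU.1 hH).2 ⟨hG, fun i a => ?_⟩⟩
  constructor
  · intro ha
    obtain ⟨i', a', hd, he⟩ := hG _ ha
    simp only [pr_inj] at he
    obtain ⟨rfl, -, rfl⟩ := he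
    obtain ⟨hi, ha'⟩ := h.dom_lt hd
    obtain ⟨b, hb, -⟩ := (h.inProd_iff.1 hH).2 i hi
    exact ⟨b, hb, (hm _ _ _).2 ⟨i, hL.self _ _ hb, fun _ => rfl, (hGK i hi a ha').1 ha⟩⟩
  · rintro ⟨b, hb, ha⟩
    obtain ⟨hi, ha'⟩ := h.dom_lt (h.dom_of_vecFun hU.1 ha).2
    obtain ⟨v, -, hv, hK'⟩ := (hm _ _ _).1 ha
    obtain rfl := hv hb
    exact (hGK _ hi a ha').2 hK'

end

end SInst

end BA

theorem lemma8p12 {l m : ℕ} (Ω : (Fin m → Fin l) → Fin l)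
    (hΩ : BA.IsSpecialWNU Ω) : BA.W11Proves.{u} (BA.coveringFml Ω) := by
  intro M hM e
  have : BA.W11 M := ⟨hM⟩
  rw [BA.holds_coveringFml]
  rintro I H ⟨hI, hH⟩
  obtain ⟨C, hC⟩ := I.exists_images_class l H
  obtain ⟨k, L, hL⟩ := hI.exists_labelling hH
  obtain ⟨J, hJ⟩ := hI.exists_covering hL
  refine ⟨C, hC, J, hJ.isInst hI hL, hJ.cov hI.toDigraphs hH hL, hJ.n_eq ▸ hL.n_le,
    fun G hG => (hC G hG).trans ⟨?_, ?_⟩⟩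
  · exact hJ.proj_of_inImages hI.toDigraphs hH hL
  · exact hJ.inImages_of_proj hI.toDigraphs hH hL
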